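/- Let $k$ be any field and let $Q$ be the quiver with three vertices $\mathbf 1,\mathbf 2,\mathbf 3$ and three arrows $\alpha\colon\mathbf 2\to\mathbf 1$, $\beta\colon\mathbf 2\to\mathbf 2$, $\gamma\colon\mathbf 3\to\mathbf 2$. Let $A$ be a finite dimensional $k$-algebra with ordinary quiver $Q$, that is, $A$ is ($k$-linearly) Morita equivalent to a quotient $kQ/I$ of the path algebra $kQ$ by an admissible ideal $I$, meaning a two-sided ideal with $(\alpha,\beta,\gamma)^N\subseteq I\subseteq(\alpha,\beta,\gamma)^2$ for some $N\ge 2$. If $A$ is of finite representation type, i.e. there are only finitely many isomorphism classes of finitely generated indecomposable $A$-modules, then the first Hochschild cohomology group $$\mathrm{HH}^1(A)=\mathrm{Der}_k(A,A)/\mathrm{Inn}(A),$$ the $k$-vector space of all $k$-derivations $A\to A$ modulo the inner ones, is not zero. -/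

import Mathlib

universe u v w x

/-! ### The path algebra of a finite quiver -/

/-- A path of a quiver, together with its source and its target. -/
@[ext] structure QuiverPath (V : Type v) [Quiver.{w} V] where
  src : V
  tgt : V
  path : Quiver.Path src tgt

/-- The path algebra `kV` of a quiver: its underlying `k`-vector space has the set of all paths
(including the trivial ones) as a basis. -/
def PathAlgebra (k : Type u) [Field k] (V : Type v) [Quiver.{w} V] : Type (max u v w) :=
  QuiverPath V →₀ k

namespace PathAlgebra

noncomputable section

variable (k : Type u) [Field k] (V : Type v) [Quiver.{w} V]

instance : AddCommGroup (PathAlgebra k V) := inferInstanceAs (AddCommGroup (QuiverPath V →₀ k))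

instance : Module k (PathAlgebra k V) := inferInstanceAs (Module k (QuiverPath V →₀ k))

variable {V}

/-- The basis element of the path algebra given by a path. -/
def ofPath (p : QuiverPath V) : PathAlgebra k V := Finsupp.single p 1

open Classical in
/-- The product of two paths: `p q` is the path "first `q`, then `p`" if `p` starts where `q` ends,
and is zero otherwise. -/
def pathMul (p q : QuiverPath V) : PathAlgebra k V :=
  if h : p.src = q.tgt then ofPath k ⟨q.src, p.tgt, q.path.comp (p.path.cast h rfl)⟩ else 0

variable (V)

/-- The bilinear extension of the product of paths. -/
def mulHom : PathAlgebra k V →ₗ[k] PathAlgebra k V →ₗ[k] PathAlgebra k V :=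
  Finsupp.linearCombination k fun p : QuiverPath V =>
    (Finsupp.linearCombination k fun q : QuiverPath V => pathMul k p q :
      (QuiverPath V →₀ k) →ₗ[k] PathAlgebra k V)

variable {V}

instance : Mul (PathAlgebra k V) := ⟨fun f g => mulHom k V f g⟩

/-- The idempotent of a vertex: the trivial path at it. -/
def idem (x : V) : PathAlgebra k V := ofPath k ⟨x, x, Quiver.Path.nil⟩

/-- An arrow, seen as an element of the path algebra. -/
def ofArrow {x y : V} (a : x ⟶ y) : PathAlgebra k V := ofPath k ⟨x, y, a.toPath⟩

instance [Fintype V] : One (PathAlgebra k V) := ⟨∑ x : V, idem k x⟩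

variable {k}

theorem mul_def (f g : PathAlgebra k V) : f * g = mulHom k V f g := rfl

theorem one_def [Fintype V] : (1 : PathAlgebra k V) = ∑ x : V, idem k x := rfl

theorem ofPath_mul_ofPath (p q : QuiverPath V) : ofPath k p * ofPath k q = pathMul k p q := by
  rw [mul_def]
  have h1 : mulHom k V (ofPath k p) = (Finsupp.linearCombination k fun q : QuiverPath V =>
      pathMul k p q : (QuiverPath V →₀ k) →ₗ[k] PathAlgebra k V) :=
    (Finsupp.linearCombination_single k (1 : k) p).trans (one_smul k _)
  rw [h1]
  exact (Finsupp.linearCombination_single k (1 : k) q).trans (one_smul k _)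

theorem hom_ext {M : Type*} [AddCommGroup M] [Module k M] {f g : PathAlgebra k V →ₗ[k] M}
    (h : ∀ p, f (ofPath k p) = g (ofPath k p)) : f = g :=
  Finsupp.lhom_ext' (M := k) fun p => LinearMap.ext_ring (h p)

theorem ofPath_mul_assoc (p q r : QuiverPath V) :
    ofPath k p * ofPath k q * ofPath k r = ofPath k p * (ofPath k q * ofPath k r) := by
  obtain ⟨a, b, p⟩ := p
  obtain ⟨c, d, q⟩ := q
  obtain ⟨e, f, r⟩ := r
  have zl : ∀ x : PathAlgebra k V, (0 : PathAlgebra k V) * x = 0 := fun x => by simp [mul_def]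
  have zr : ∀ x : PathAlgebra k V, x * (0 : PathAlgebra k V) = 0 := fun x => by simp [mul_def]
  simp only [ofPath_mul_ofPath]
  by_cases h : a = d
  · subst h
    by_cases h' : c = f
    · subst h'
      simp [pathMul, ofPath_mul_ofPath]
    · simp [pathMul, ofPath_mul_ofPath, h', zr]
  · by_cases h' : c = f
    · subst h'
      simp [pathMul, ofPath_mul_ofPath, h, zl]
    · simp [pathMul, h, h', zl, zr]

theorem mul_assoc_aux (x y z : PathAlgebra k V) : x * y * z = x * (y * z) := by
  have key : (mulHom k V).compr₂ (mulHom k V) =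
      (LinearMap.llcomp k (PathAlgebra k V) (PathAlgebra k V) (PathAlgebra k V)).compl₁₂
        (mulHom k V) (mulHom k V) := by
    refine hom_ext fun p => hom_ext fun q => hom_ext fun r => ?_
    exact ofPath_mul_assoc p q r
  exact congrArg (fun F => F x y z) key

theorem idem_mul_ofPath (x : V) (p : QuiverPath V) [Decidable (x = p.tgt)] :
    idem k x * ofPath k p = if x = p.tgt then ofPath k p else 0 := by
  obtain ⟨a, b, p⟩ := p
  rw [idem, ofPath_mul_ofPath, pathMul]
  by_cases h : x = b
  · subst h
    simp
  · simp [h]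

theorem ofPath_mul_idem (x : V) (p : QuiverPath V) [Decidable (p.src = x)] :
    ofPath k p * idem k x = if p.src = x then ofPath k p else 0 := by
  obtain ⟨a, b, p⟩ := p
  rw [idem, ofPath_mul_ofPath, pathMul]
  by_cases h : a = x
  · subst h
    simp
  · simp [h]

theorem one_mul_aux [Fintype V] (x : PathAlgebra k V) : 1 * x = x := by
  classical
  have key : mulHom k V 1 = LinearMap.id := by
    refine hom_ext fun p => ?_
    simp only [one_def, map_sum, LinearMap.sum_apply, ← mul_def, idem_mul_ofPath]
    simp
  exact congrArg (fun F => F x) key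

theorem mul_one_aux [Fintype V] (x : PathAlgebra k V) : x * 1 = x := by
  classical
  have key : (mulHom k V).flip 1 = LinearMap.id := by
    refine hom_ext fun p => ?_
    simp only [one_def, map_sum, LinearMap.sum_apply, LinearMap.flip_apply, ← mul_def,
      ofPath_mul_idem]
    simp
  exact congrArg (fun F => F x) key

instance [Fintype V] : Ring (PathAlgebra k V) :=
  { (inferInstance : AddCommGroup (PathAlgebra k V)),
    (inferInstance : Mul (PathAlgebra k V)),
    (inferInstance : One (PathAlgebra k V)) with
    left_distrib := fun x y z => map_add (mulHom k V x) y z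
    right_distrib := fun x y z => by simp [mul_def]
    zero_mul := fun x => by simp [mul_def]
    mul_zero := fun x => by simp [mul_def]
    mul_assoc := mul_assoc_aux
    one_mul := one_mul_aux
    mul_one := mul_one_aux }

instance [Fintype V] : Algebra k (PathAlgebra k V) :=
  Algebra.ofModule (fun r x y => by simp [mul_def]) (fun r x y => by simp [mul_def])

variable (k V)

/-- The two-sided ideal generated by all arrows. -/
def arrowIdeal [Fintype V] : Ideal (PathAlgebra k V) :=
  (TwoSidedIdeal.span {f : PathAlgebra k V | ∃ (x y : V) (a : x ⟶ y), f = ofArrow k a}).asIdeal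

instance [Fintype V] : (arrowIdeal k V).IsTwoSided := by
  unfold arrowIdeal
  infer_instance

variable {k V}

/-- An ideal `I` (taken two-sided wherever this is used) is admissible if
`(arrows)^N ⊆ I ⊆ (arrows)^2` for some `N ≥ 2`. -/
def IsAdmissible [Fintype V] (I : Ideal (PathAlgebra k V)) : Prop :=
  I ≤ arrowIdeal k V ^ 2 ∧ ∃ N : ℕ, 2 ≤ N ∧ arrowIdeal k V ^ N ≤ I

end

end PathAlgebra

/-- The `k`-algebra `A` has ordinary quiver `V`: it is (`k`-linearly) Morita equivalent to the
quotient of the path algebra `kV` by an admissible two-sided ideal. -/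
def HasOrdinaryQuiver (k : Type u) [Field k] (A : Type v) [Ring A] [Algebra k A]
    (V : Type w) [Quiver.{x} V] [Fintype V] : Prop :=
  ∃ (I : Ideal (PathAlgebra k V)) (_ : I.IsTwoSided),
    PathAlgebra.IsAdmissible I ∧ IsMoritaEquivalent k A (PathAlgebra k V ⧸ I)

/-! ### The quiver with three vertices `1, 2, 3` and arrows `α : 2 → 1`, `β : 2 → 2`, `γ : 3 → 2` -/

inductive LoopVertex : Type
  | one
  | two
  | three

inductive LoopArrow : LoopVertex → LoopVertex → Type
  | α : LoopArrow .two .one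
  | β : LoopArrow .two .two
  | γ : LoopArrow .three .two

instance : Quiver.{0} LoopVertex := ⟨LoopArrow⟩

instance : DecidableEq LoopVertex := fun x y => by
  cases x <;> cases y <;> first | exact isTrue rfl | exact isFalse (fun h => nomatch h)

instance : Fintype LoopVertex :=
  ⟨{.one, .two, .three}, fun x => by cases x <;> simp⟩

/-! ### The first Hochschild cohomology -/

/-- The `k`-vector space of `k`-derivations `A → A` of a (noncommutative) `k`-algebra. -/
def derivationSpace (k : Type u) [Field k] (A : Type v) [Ring A] [Algebra k A] :
    Submodule k (A →ₗ[k] A) where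
  carrier := {D | ∀ x y : A, D (x * y) = D x * y + x * D y}
  add_mem' := by
    intro D E hD hE x y
    simp only [LinearMap.add_apply, hD x y, hE x y]
    noncomm_ring
  zero_mem' := fun x y => by simp
  smul_mem' := by
    intro c D hD x y
    simp only [LinearMap.smul_apply, hD x y, smul_add, smul_mul_assoc, mul_smul_comm]

/-- The map sending `a` to the inner derivation `[a, -] : x ↦ a x - x a`. -/
def innerDerivation (k : Type u) [Field k] (A : Type v) [Ring A] [Algebra k A] :
    A →ₗ[k] derivationSpace k A where
  toFun a := ⟨LinearMap.mulLeft k a - LinearMap.mulRight k a, fun x y => by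
    simp only [LinearMap.sub_apply, LinearMap.mulLeft_apply, LinearMap.mulRight_apply]
    noncomm_ring⟩
  map_add' a b := by
    ext x
    simp only [LinearMap.sub_apply, LinearMap.mulLeft_apply, LinearMap.mulRight_apply,
      Submodule.coe_add, LinearMap.add_apply]
    noncomm_ring
  map_smul' c a := by
    ext x
    simp [smul_sub]

/-- The first Hochschild cohomology `Der / Inn`: the quotient vector space of derivations modulo
inner derivations. -/
abbrev HochschildH1 (k : Type u) [Field k] (A : Type v) [Ring A] [Algebra k A] : Type v :=
  @HasQuotient.Quotient (derivationSpace k A) _ Submodule.hasQuotient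
    (LinearMap.range (innerDerivation k A))

/-! ### Finite representation type -/

/-- A module is indecomposable if it is nonzero and not the internal direct sum of two nonzero
submodules. -/
def IsIndecomposableModule (A : Type u) [Ring A] (M : Type v) [AddCommGroup M] [Module A M] :
    Prop :=
  Nontrivial M ∧ ∀ N N' : Submodule A M, IsCompl N N' → N = ⊥ ∨ N' = ⊥

/-- `A` is of finite representation type: up to isomorphism there are only finitely many finitely
generated indecomposable `A`-modules. -/
def IsOfFiniteRepresentationType (A : Type u) [Ring A] : Prop :=
  ∃ (n : ℕ) (X : Fin n → ModuleCat.{u} A), ∀ (M : Type u) [AddCommGroup M] [Module A M]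
    [Module.Finite A M], IsIndecomposableModule A M → ∃ i, Nonempty (M ≃ₗ[A] X i)

/-! Sending a path to x to the power of the number of its loops, placed at (target, source), embeds
kQ in the triangular 3×3 matrices over k[x], with constant (1,1) and (3,3) entries. The kernel I of
kQ → B = kQ/I splits into matrix entries: ideals of k[x] at (2,2), (1,2), (2,3), and only a subspace
W at (1,3). Admissibility makes the (2,2) ideal (x^n) with n ≥ 2, and W contains x^n k[x].

For x ∣ p and any s, the derivation p d/dx + [diag(s,0,0), -] of the matrix ring preserves kQ and
the three ideals, each being generated by a power of x. It descends to B once p d/dx + s preserves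
W, and it is not inner if x^n ∤ p. Linear algebra modulo x^n provides such p and s whenever n ≤ 3 or
x^(n-1) ∈ W (`exists_differential_operator`).

In the remaining case n ≥ 4 and x^(n-1) ∉ W. The (2,3) ideal is then contained in (x^n), since
otherwise x^(n-1) would lie in it and hence in W. So every linear map U → V into a space with an
operator T, T^4 = 0, is a B-module with zero space at vertex 1. Taking T with Jordan blocks of sizes
4 and 2 over k[t]/(t^(m+1)), and a suitable two-generator U, gives one module for each m. Idempotent
endomorphisms are controlled by the commutant of t, which is local (`idempotent_trivial`), so these
modules are indecomposable; their dimensions 8(m+1) are distinct. This contradicts finite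
representation type.

Both halves pass between A and B through the progenerator of the Morita equivalence
(`MoritaEquivalence.nontrivial_hochschildH1`,
`MoritaEquivalence.false_of_isOfFiniteRepresentationType`). -/

/-! ### Derivations under Morita equivalence -/

/-- A derivation of `B` lifts to a connection on any projective `B`-module. -/
theorem exists_connection {k : Type u} [Field k] {B : Type v} [Ring B] [Algebra k B]
    {P : Type w} [AddCommGroup P] [Module B P] [Module k P] [IsScalarTower k B P]
    [Module.Projective B P] {D : B →ₗ[k] B} (hD : D ∈ derivationSpace k B) :
    ∃ N : P →ₗ[k] P, ∀ (b : B) (p : P), N (b • p) = D b • p + b • N p := by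
  obtain ⟨s, hs⟩ := Module.projective_def'.1 (inferInstance : Module.Projective B P)
  have hD' : ∀ x y : B, D (x * y) = D x * y + x * D y := hD
  -- On a free module D acts coordinatewise; this is compressed to the direct summand P by the
  -- splitting s.
  refine ⟨((Finsupp.linearCombination B id).restrictScalars k) ∘ₗ
    (Finsupp.mapRange.linearMap D) ∘ₗ (s.restrictScalars k), fun b p => ?_⟩
  have key : ∀ f : P →₀ B, Finsupp.mapRange.linearMap D (b • f) =
      D b • f + b • Finsupp.mapRange.linearMap D f := fun f => by
    ext i
    simp [hD']
  have hs' : Finsupp.linearCombination B id (s p) = p := LinearMap.congr_fun hs p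
  simp [key, hs']

/-- If all derivations of the endomorphism ring of a projective generator are inner, then so are
all derivations of the ring itself. -/
theorem mem_range_innerDerivation_of_generator {k : Type u} [Field k] {B : Type v} [Ring B]
    [Algebra k B] {P : Type w} [AddCommGroup P] [Module B P] [Module k P] [IsScalarTower k B P]
    [Module.Projective B P] {n : ℕ} (φ : Fin n → P →ₗ[B] B) (q : Fin n → P)
    (hφ : ∑ i, φ i (q i) = 1)
    (h : ∀ E ∈ derivationSpace k (Module.End B P),
      ∃ g : Module.End B P, ∀ f, E f = g * f - f * g)
    (D : derivationSpace k B) : D ∈ LinearMap.range (innerDerivation k B) := by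
  obtain ⟨D, hD⟩ := D
  have hD' : ∀ x y : B, D (x * y) = D x * y + x * D y := hD
  have hD1 : D 1 = 0 := by simpa using hD' 1 1
  obtain ⟨N, hN⟩ := exists_connection (P := P) hD
  -- The commutator with N is B-linear because the terms with D b cancel.
  let E : Module.End B P →ₗ[k] Module.End B P :=
    { toFun := fun f =>
        { toFun := fun p => N (f p) - f (N p)
          map_add' := fun p p' => by simp only [map_add]; abel
          map_smul' := fun b p => by
            simp only [map_smul, hN, map_add, smul_sub, RingHom.id_apply]; abel }
      map_add' := fun f f' => by
        ext p; simp only [LinearMap.coe_mk, AddHom.coe_mk, LinearMap.add_apply, map_add]; abel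
      map_smul' := fun c f => by
        ext p; simp [smul_sub] }
  have hE : ∀ f p, E f p = N (f p) - f (N p) := fun f p => rfl
  obtain ⟨g, hg⟩ := h E (fun f f' => by
    ext p
    simp only [hE, Module.End.mul_apply, LinearMap.add_apply, map_sub]; abel)
  have comm : ∀ (f : Module.End B P) (p : P), N (f p) - g (f p) = f (N p - g p) := fun f p => by
    have := LinearMap.congr_fun (hg f) p
    simp only [hE, LinearMap.sub_apply, Module.End.mul_apply] at this
    rw [map_sub, sub_eq_sub_iff_add_eq_add, add_comm (f (N p)), ← sub_eq_sub_iff_add_eq_add, this]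
  -- N - g commutes with every endomorphism of the generator P, so it must be multiplication by a
  -- scalar. Testing on the rank-one maps φ i (-) • p and summing identifies that scalar, as D 1 =
  -- 0.
  let c : B := ∑ i, φ i (N (q i) - g (q i))
  have hc : ∀ p, N p - g p = c • p := fun p => by
    have h1 : ∀ i, D (φ i (q i)) • p + φ i (q i) • (N p - g p) = φ i (N (q i) - g (q i)) • p :=
      fun i => by
        have := comm ((φ i).smulRight p) (q i)
        simp only [LinearMap.smulRight_apply, hN, map_smul] at this
        rw [← this, smul_sub]
        abel
    have h2 := Finset.sum_congr rfl (fun i (_ : i ∈ Finset.univ) => h1 i)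
    rwa [Finset.sum_add_distrib, ← Finset.sum_smul, ← Finset.sum_smul, ← Finset.sum_smul,
      ← map_sum, hφ, hD1, zero_smul, zero_add, one_smul] at h2
  refine ⟨c, Subtype.ext (LinearMap.ext fun b => ?_)⟩
  have h3 : ∀ p : P, (c * b - b * c) • p = D b • p := fun p => by
    have h4 := hc (b • p)
    rw [hN, map_smul] at h4
    rw [sub_smul, mul_smul, mul_smul, ← h4, ← hc p, smul_sub]
    abel
  have h5 : ∀ i, (c * b - b * c) * φ i (q i) = D b * φ i (q i) := fun i => by
    simpa using congrArg (φ i) (h3 (q i))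
  have h6 := Finset.sum_congr rfl (fun i (_ : i ∈ Finset.univ) => h5 i)
  rw [← Finset.mul_sum, ← Finset.mul_sum, hφ, mul_one, mul_one] at h6
  exact h6

/-- Linear maps out of a copy of the regular module correspond to elements. -/
def linearMapEquivOfRegular (k : Type u) [Field k] {A : Type v} [Ring A] [Algebra k A]
    {G : Type w} [AddCommGroup G] [Module A G] (i : A ≃ₗ[A] G)
    (X : Type x) [AddCommGroup X] [Module A X] [Module k X] [IsScalarTower k A X] :
    (G →ₗ[A] X) ≃ₗ[k] X where
  toFun f := f (i 1)
  map_add' _ _ := rfl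
  map_smul' _ _ := rfl
  invFun x := (LinearMap.toSpanSingleton A X x).comp i.symm.toLinearMap
  left_inv f := by
    ext g
    obtain ⟨a, rfl⟩ := i.surjective g
    simp [← map_smul]
  right_inv x := by simp

theorem linearMapEquivOfRegular_symm_apply (k : Type u) [Field k] {A : Type v} [Ring A]
    [Algebra k A] {G : Type w} [AddCommGroup G] [Module A G] (i : A ≃ₗ[A] G)
    (X : Type x) [AddCommGroup X] [Module A X] [Module k X] [IsScalarTower k A X] (x : X) (a : A) :
    (linearMapEquivOfRegular k i X).symm x (i a) = a • x :=
  congrArg (fun b : A => b • x) (i.symm_apply_apply a)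

-- The quotient map from B by the trace ideal of P is killed by every map P → B. As P separates
-- morphisms, that map is zero, so 1 lies in the trace ideal.
open CategoryTheory in
theorem ModuleCat.exists_sum_eq_one_of_isSeparator {B : Type v} [Ring B]
    {P : ModuleCat.{max v w} B} (hP : IsSeparator P) :
    ∃ (n : ℕ) (φ : Fin n → P →ₗ[B] B) (q : Fin n → P), ∑ i, φ i (q i) = 1 := by
  let T : Submodule B B := Submodule.span B {b | ∃ (φ : P →ₗ[B] B) (p : P), φ p = b}
  let X : ModuleCat.{max v w} B := ModuleCat.of B (ULift.{w} B)
  let Y : ModuleCat.{max v w} B := ModuleCat.of B (ULift.{w} (B ⧸ T))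
  let m : ULift.{w} B →ₗ[B] ULift.{w} (B ⧸ T) :=
    ULift.moduleEquiv.symm.toLinearMap ∘ₗ T.mkQ ∘ₗ ULift.moduleEquiv.toLinearMap
  let f : X ⟶ Y := ModuleCat.ofHom m
  have hf : f = 0 := (isSeparator_def P).1 hP f 0 fun h => by
    rw [Limits.comp_zero]
    ext p
    change T.mkQ ((ULift.moduleEquiv.toLinearMap ∘ₗ h.hom) p) = 0
    exact (Submodule.Quotient.mk_eq_zero T).2 (Submodule.subset_span ⟨_, p, rfl⟩)
  have h1 : T.mkQ 1 = 0 :=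
    congrArg ULift.down (LinearMap.congr_fun (congrArg ModuleCat.Hom.hom hf) (ULift.up 1))
  obtain ⟨n, c, g, hg⟩ := Submodule.mem_span_set'.1 ((Submodule.Quotient.mk_eq_zero T).1 h1)
  choose φ q hφ using fun i => (g i).2
  exact ⟨n, φ, fun i => c i • q i, by simpa [hφ] using hg⟩

open CategoryTheory in
open scoped ModuleCat.Algebra in
/-- A Morita equivalence yields a projective generator whose endomorphism ring is the opposite of
the given algebra and which represents the inverse equivalence. -/
theorem MoritaEquivalence.exists_progenerator {k : Type u} [Field k] {A : Type v} [Ring A]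
    [Algebra k A] {B : Type w} [Ring B] [Algebra k B] (e : MoritaEquivalence k A B) :
    ∃ P : ModuleCat.{max v w} B, Module.Projective B P ∧
      (∃ (n : ℕ) (φ : Fin n → P →ₗ[B] B) (q : Fin n → P), ∑ i, φ i (q i) = 1) ∧
      (∃ σ : A ≃ₗ[k] Module.End B P, ∀ x y, σ (x * y) = σ y * σ x) ∧
      ∀ Y : ModuleCat.{max v w} B, Nonempty (e.eqv.inverse.obj Y ≃ₗ[k] (P →ₗ[B] Y)) := by
  have := e.linear
  obtain ⟨G, ⟨i⟩⟩ : ∃ G : ModuleCat.{max v w} A, Nonempty (A ≃ₗ[A] G) :=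
    ⟨ModuleCat.of A (ULift.{w} A), ⟨ULift.moduleEquiv.symm⟩⟩
  have hsep : IsSeparator G := (isSeparator_def G).2 fun X Y f g h => by
    ext x
    have h1 := h (ModuleCat.ofHom ((linearMapEquivOfRegular k i X).symm x))
    have h2 := LinearMap.congr_fun (congrArg ModuleCat.Hom.hom h1) (i 1)
    simpa [linearMapEquivOfRegular_symm_apply] using h2
  have hproj : Projective G := by
    have : Module.Projective A G := .of_equiv i
    infer_instance
  have hFG : Projective (e.eqv.functor.obj G) := (e.eqv.map_projective_iff G).2 hproj
  have homEquiv : ∀ X : ModuleCat.{max v w} A,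
      Nonempty {τ : X ≃ₗ[k] (e.eqv.functor.obj G →ₗ[B] e.eqv.functor.obj X) //
        ∀ x, τ x = (e.eqv.functor.map
          (ModuleCat.ofHom ((linearMapEquivOfRegular k i X).symm x) : G ⟶ X)).hom} := fun X =>
    ⟨⟨(((linearMapEquivOfRegular k i X).symm.trans
      (ModuleCat.homLinearEquiv (S := k) (M := G) (N := X)).symm).trans
      (LinearEquiv.ofBijective (e.eqv.functor.mapLinearMap k)
        ⟨e.eqv.functor.map_injective, e.eqv.functor.map_surjective⟩)).trans
      (ModuleCat.homLinearEquiv (S := k)), fun x => rfl⟩⟩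
  refine ⟨e.eqv.functor.obj G, ?_, ModuleCat.exists_sum_eq_one_of_isSeparator ?_, ?_,
    fun Y => ?_⟩
  · have : Small.{max v w} B := ⟨⟨ULift.{v} B, ⟨Equiv.ulift.symm⟩⟩⟩
    infer_instance
  · exact hsep.of_equivalence e.eqv
  · obtain ⟨τ, hτ⟩ := homEquiv G
    refine ⟨(i.restrictScalars k).trans τ, fun x y => ?_⟩
    change τ (i (x * y)) = τ (i y) * τ (i x)
    rw [hτ, hτ, hτ]
    change _ = ModuleCat.Hom.hom (e.eqv.functor.map _ ≫ e.eqv.functor.map _)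
    rw [← Functor.map_comp]
    congr 2
    ext g
    obtain ⟨a, rfl⟩ := i.surjective g
    simp only [ModuleCat.hom_ofHom, ModuleCat.hom_comp, LinearMap.comp_apply,
      linearMapEquivOfRegular_symm_apply, ← map_smul, smul_eq_mul, mul_assoc]
  · obtain ⟨τ, -⟩ := homEquiv (e.eqv.inverse.obj Y)
    let c : e.eqv.functor.obj (e.eqv.inverse.obj Y) ≅ Y := e.eqv.counitIso.app Y
    exact ⟨τ.trans ((ModuleCat.homLinearEquiv (S := k)).symm.trans
      ((Linear.homCongr k (Iso.refl _) c).trans (ModuleCat.homLinearEquiv (S := k))))⟩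

/-- The nonvanishing of the first Hochschild cohomology is invariant under Morita equivalence. -/
theorem MoritaEquivalence.nontrivial_hochschildH1 {k : Type u} [Field k] {A : Type v} [Ring A]
    [Algebra k A] {B : Type w} [Ring B] [Algebra k B] (e : MoritaEquivalence k A B)
    {D : derivationSpace k B} (hD : D ∉ LinearMap.range (innerDerivation k B)) :
    Nontrivial (HochschildH1 k A) := by
  obtain ⟨P, hP, ⟨n, φ, q, hφ⟩, ⟨σ, hσ⟩, -⟩ := e.exists_progenerator
  let _ : Module k P := ModuleCat.moduleOfAlgebraModule P
  have : IsScalarTower k B P := ModuleCat.isScalarTower_of_algebra_moduleCat P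
  have hσ' : ∀ f g, σ.symm (f * g) = σ.symm g * σ.symm f := fun f g => by
    apply σ.injective
    simp [hσ]
  by_contra hA
  have htop : LinearMap.range (innerDerivation k A) = ⊤ :=
    Submodule.Quotient.subsingleton_iff.1 (not_nontrivial_iff_subsingleton.1 hA)
  refine hD (mem_range_innerDerivation_of_generator φ q hφ (fun E hE => ?_) D)
  have hE' : ∀ f g, E (f * g) = E f * g + f * E g := hE
  have hmem : σ.symm.toLinearMap ∘ₗ E ∘ₗ σ.toLinearMap ∈ derivationSpace k A := fun x y => by
    simp [hσ, hE', hσ', add_comm]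
  obtain ⟨a, ha⟩ : (⟨_, hmem⟩ : derivationSpace k A) ∈ LinearMap.range (innerDerivation k A) :=
    htop ▸ Submodule.mem_top
  -- The sign appears because σ reverses products.
  refine ⟨-σ a, fun f => ?_⟩
  have h1 := LinearMap.congr_fun (congrArg Subtype.val ha) (σ.symm f)
  change a * σ.symm f - σ.symm f * a = σ.symm (E (σ (σ.symm f))) at h1
  have h2 := congrArg σ h1
  simp only [map_sub, hσ, LinearEquiv.apply_symm_apply] at h2
  rw [← h2]
  noncomm_ring

/-! ### Finite representation type under Morita equivalence -/

/-- A nonzero module whose endomorphism ring has no nontrivial idempotents is indecomposable. -/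
theorem isIndecomposableModule_of_idempotent {A : Type u} [Ring A] {M : Type v} [AddCommGroup M]
    [Module A M] [Nontrivial M] (h : ∀ f : Module.End A M, f * f = f → f = 0 ∨ f = 1) :
    IsIndecomposableModule A M := by
  refine ⟨inferInstance, fun N N' hN => ?_⟩
  rcases h (N.projection N' hN) (by ext x; simp) with h0 | h1
  · left
    rw [Submodule.eq_bot_iff]
    intro x hx
    have h2 : N.projection N' hN x = 0 := LinearMap.congr_fun h0 x
    rwa [Submodule.projection_apply, Submodule.projectionOnto_apply_of_mem_left hN hx] at h2
  · right
    rw [Submodule.eq_bot_iff]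
    intro x hx
    have h2 : N.projection N' hN x = x := LinearMap.congr_fun h1 x
    rw [← h2, Submodule.projection_apply, (Submodule.projectionOnto_apply_eq_zero_iff hN).2 hx]
    rfl

theorem Module.End.idempotent_of_linearEquiv {A : Type u} [Ring A] {M : Type v} [AddCommGroup M]
    [Module A M] {M' : Type w} [AddCommGroup M'] [Module A M'] (i : M ≃ₗ[A] M')
    (h : ∀ f : Module.End A M, f * f = f → f = 0 ∨ f = 1) (f : Module.End A M') (hf : f * f = f) :
    f = 0 ∨ f = 1 := by
  refine (h (i.conjRingEquiv.symm f) (by rw [← map_mul, hf])).imp (fun h => ?_) (fun h => ?_)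
  · simpa using h
  · simpa using h

open CategoryTheory in
open scoped ModuleCat.Algebra in
/-- An algebra of finite representation type that is Morita equivalent to `B` excludes infinite
families of pairwise nonisomorphic finite dimensional `B`-modules whose endomorphism rings have no
nontrivial idempotents. -/
theorem MoritaEquivalence.false_of_isOfFiniteRepresentationType {k : Type u} [Field k]
    {A : Type v} [Ring A] [Algebra k A] [FiniteDimensional k A] {B : Type w} [Ring B] [Algebra k B]
    (e : MoritaEquivalence k A B) (hfin : IsOfFiniteRepresentationType A)
    (Y : ℕ → Type w) [∀ m, AddCommGroup (Y m)] [∀ m, Module B (Y m)] [∀ m, Module k (Y m)]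
    [∀ m, IsScalarTower k B (Y m)] [∀ m, FiniteDimensional k (Y m)] [∀ m, Nontrivial (Y m)]
    (hY : ∀ (m : ℕ) (f : Module.End B (Y m)), f * f = f → f = 0 ∨ f = 1)
    (hinj : ∀ m m', Nonempty (Y m ≃ₗ[B] Y m') → m = m') : False := by
  obtain ⟨P, -, ⟨n, φ, q, hφ⟩, ⟨σ, -⟩, hP⟩ := e.exists_progenerator
  have hE : FiniteDimensional k (Module.End B P) := σ.finiteDimensional
  have hPfin : FiniteDimensional k P := by
    -- The rank-one maps φ i (-) • p determine p because ∑ φ i (q i) = 1. Thus P embeds in finitely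
    -- many copies of End P ≅ A.
    let j : P →ₗ[k] Fin n → Module.End B P := LinearMap.pi fun i =>
      { toFun := fun p => (φ i).smulRight p
        map_add' := fun p p' => by ext; simp
        map_smul' := fun c p => by ext r; exact smul_comm (φ i r) c p }
    refine FiniteDimensional.of_injective j fun p p' h => ?_
    have h1 : ∀ i, φ i (q i) • p = φ i (q i) • p' := fun i =>
      LinearMap.congr_fun (congrFun h i) (q i)
    have h2 := Finset.sum_congr rfl (fun i (_ : i ∈ Finset.univ) => h1 i)
    rwa [← Finset.sum_smul, ← Finset.sum_smul, hφ, one_smul, one_smul] at h2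
  obtain ⟨Z, hYZ⟩ : ∃ Z : ℕ → ModuleCat.{max v w} B, ∀ m, Nonempty (Y m ≃ₗ[B] Z m) :=
    ⟨fun m => ModuleCat.of B (ULift.{v} (Y m)), fun m => ⟨ULift.moduleEquiv.symm⟩⟩
  let z := fun m => (hYZ m).some
  let H := e.eqv.inverse
  have hZ : ∀ (m : ℕ) (f : Z m ⟶ Z m), f ≫ f = f → f = 0 ∨ f = 𝟙 _ := fun m f hf => by
    refine (Module.End.idempotent_of_linearEquiv (z m) (hY m) f.hom
      (congrArg ModuleCat.Hom.hom hf)).imp (fun h => ?_) (fun h => ?_)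
    · exact ModuleCat.hom_ext h
    · exact ModuleCat.hom_ext h
  have hX : ∀ (m : ℕ) (f : Module.End A (H.obj (Z m))), f * f = f → f = 0 ∨ f = 1 :=
    fun m f hf => by
      obtain ⟨g, hg⟩ := H.map_surjective (ModuleCat.ofHom f)
      have hf' : f = (H.map g).hom := by rw [hg]; rfl
      have hgg : g ≫ g = g := H.map_injective (by
        rw [H.map_comp, hg, ← ModuleCat.ofHom_comp]
        exact congrArg ModuleCat.ofHom hf)
      rcases hZ m g hgg with rfl | rfl
      · left; rw [hf', H.map_zero]; rfl
      · right; rw [hf', H.map_id]; rfl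
  have hXnt : ∀ m, Nontrivial (H.obj (Z m)) := fun m => by
    by_contra hn
    have := not_nontrivial_iff_subsingleton.1 hn
    have h0 : H.map (𝟙 (Z m)) = H.map 0 := by
      ext x
      exact Subsingleton.elim _ _
    obtain ⟨y, hy⟩ := exists_ne (0 : Y m)
    have h1 := LinearMap.congr_fun (congrArg ModuleCat.Hom.hom (H.map_injective h0)) (z m y)
    exact hy ((z m).map_eq_zero_iff.1 h1)
  have hZfin : ∀ m, FiniteDimensional k (Z m) := fun m =>
    ((z m).restrictScalars k).finiteDimensional
  have hXfin : ∀ m, Module.Finite A (H.obj (Z m)) := fun m => by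
    obtain ⟨τ⟩ := hP (Z m)
    have : FiniteDimensional k (P →ₗ[B] Z m) :=
      FiniteDimensional.of_injective (LinearMap.restrictScalarsₗ k B P (Z m) k)
        (LinearMap.restrictScalars_injective k)
    have : FiniteDimensional k (H.obj (Z m)) := τ.symm.finiteDimensional
    exact Module.Finite.of_restrictScalars_finite k A _
  obtain ⟨N, X, hNX⟩ := hfin
  have key : ∀ m, ∃ i, Nonempty (H.obj (Z m) ≃ₗ[A] X i) := fun m => by
    -- A quotient of A^r is a copy of the module in the universe of A, where finite representation
    -- type is formulated.
    obtain ⟨r, f, hf⟩ := Module.Finite.exists_fin' A (H.obj (Z m))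
    let i := f.quotKerEquivOfSurjective hf
    have : Nontrivial ((Fin r → A) ⧸ LinearMap.ker f) := i.toEquiv.nontrivial
    obtain ⟨t, ⟨ht⟩⟩ := hNX _ (isIndecomposableModule_of_idempotent
      (Module.End.idempotent_of_linearEquiv i.symm (hX m)))
    exact ⟨t, ⟨i.symm.trans ht⟩⟩
  choose t ht using key
  obtain ⟨m, m', hne, heq⟩ := Finite.exists_ne_map_eq_of_infinite t
  obtain ⟨i⟩ := ht m
  obtain ⟨i'⟩ := ht m'
  rw [← heq] at i'
  let j : Z m ≅ Z m' := H.preimageIso (i.trans i'.symm).toModuleIso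
  exact hne (hinj m m' ⟨(z m).trans (j.toLinearEquiv.trans (z m').symm)⟩)

/-! ### The path algebra as triangular matrices over k[x] -/

noncomputable section

namespace LoopQuiver

open PathAlgebra Polynomial LoopVertex

/-- The number of occurrences of the loop in an arrow. -/
def arrowDegree : ∀ {x y : LoopVertex}, (x ⟶ y) → ℕ
  | _, _, LoopArrow.α => 0
  | _, _, LoopArrow.β => 1
  | _, _, LoopArrow.γ => 0

/-- The number of occurrences of the loop in a path. -/
def pathDegree {x : LoopVertex} : ∀ {y : LoopVertex}, Quiver.Path x y → ℕ
  | _, .nil => 0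
  | _, .cons p a => pathDegree p + arrowDegree a

theorem pathDegree_comp {x y : LoopVertex} (p : Quiver.Path x y) :
    ∀ {z : LoopVertex} (q : Quiver.Path y z), pathDegree (p.comp q) = pathDegree p + pathDegree q
  | _, .nil => rfl
  | _, .cons q a => by
    rw [Quiver.Path.comp_cons, pathDegree, pathDegree, pathDegree_comp p q, add_assoc]

theorem sum_vertices {M : Type*} [AddCommMonoid M] (f : LoopVertex → M) :
    ∑ i, f i = f one + f two + f three := by
  change ∑ i ∈ ({one, two, three} : Finset LoopVertex), f i = _
  rw [Finset.sum_insert (by simp), Finset.sum_insert (by simp), Finset.sum_singleton, add_assoc]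

variable (k : Type u) [Field k]

/-- The path algebra as an algebra of triangular matrices over the polynomial ring. -/
def toMatrix : PathAlgebra k LoopVertex →ₐ[k] Matrix LoopVertex LoopVertex k[X] :=
  let F : PathAlgebra k LoopVertex →ₗ[k] Matrix LoopVertex LoopVertex k[X] :=
    Finsupp.linearCombination k fun p : QuiverPath LoopVertex =>
      Matrix.single p.tgt p.src (X ^ pathDegree p.path)
  have hF : ∀ p, F (ofPath k p) = Matrix.single p.tgt p.src (X ^ pathDegree p.path) := fun p =>
    (Finsupp.linearCombination_single k (1 : k) p).trans (one_smul k _)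
  AlgHom.ofLinearMap F
    (by
      rw [one_def, map_sum, sum_vertices]
      simp only [idem, hF]
      ext i j : 2
      cases i <;> cases j <;> simp [pathDegree])
    (by
      have key : (mulHom k LoopVertex).compr₂ F =
          (LinearMap.mul k (Matrix LoopVertex LoopVertex k[X])).compl₁₂ F F := by
        refine hom_ext fun p => hom_ext fun q => ?_
        change F (ofPath k p * ofPath k q) = F (ofPath k p) * F (ofPath k q)
        rw [ofPath_mul_ofPath, hF, hF]
        obtain ⟨a, b, p⟩ := p
        obtain ⟨c, d, q⟩ := q
        by_cases h : a = d
        · subst h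
          simp [pathMul, hF, pathDegree_comp, pow_add, mul_comm]
        · simp [pathMul, h]
      exact fun f g => congrArg (fun G => G f g) key)

theorem toMatrix_ofPath (p : QuiverPath LoopVertex) :
    toMatrix k (ofPath k p) = Matrix.single p.tgt p.src (X ^ pathDegree p.path) :=
  (Finsupp.linearCombination_single k (1 : k) p).trans (one_smul k _)

theorem toMatrix_idem (x : LoopVertex) : toMatrix k (idem k x) = Matrix.single x x 1 := by
  simp [idem, toMatrix_ofPath, pathDegree]

/-- The arrow `α`. -/
def a : PathAlgebra k LoopVertex := ofArrow k LoopArrow.α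
/-- The loop `β`. -/
def b : PathAlgebra k LoopVertex := ofArrow k LoopArrow.β
/-- The arrow `γ`. -/
def c : PathAlgebra k LoopVertex := ofArrow k LoopArrow.γ

theorem toMatrix_a : toMatrix k (a k) = Matrix.single one two 1 := by
  simp [a, ofArrow, toMatrix_ofPath, pathDegree, arrowDegree, Quiver.Hom.toPath]
theorem toMatrix_b : toMatrix k (b k) = Matrix.single two two X := by
  simp [b, ofArrow, toMatrix_ofPath, pathDegree, arrowDegree, Quiver.Hom.toPath]
theorem toMatrix_c : toMatrix k (c k) = Matrix.single two three 1 := by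
  simp [c, ofArrow, toMatrix_ofPath, pathDegree, arrowDegree, Quiver.Hom.toPath]

theorem idem_mul_idem (x : LoopVertex) : idem k x * idem k x = idem k x := by
  classical
  have := idem_mul_ofPath (k := k) x ⟨x, x, Quiver.Path.nil⟩
  simpa [idem] using this

theorem ofArrow_mul_idem {x y : LoopVertex} (f : x ⟶ y) (z : LoopVertex) :
    ofArrow k f * idem k z = if x = z then ofArrow k f else 0 :=
  ofPath_mul_idem z _

theorem idem_mul_ofArrow {x y : LoopVertex} (f : x ⟶ y) (z : LoopVertex) :
    idem k z * ofArrow k f = if z = y then ofArrow k f else 0 :=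
  idem_mul_ofPath z _

/-- Polynomials in the loop at the middle vertex. -/
def loopPoly : k[X] →ₗ[k] PathAlgebra k LoopVertex :=
  LinearMap.mulRight k (idem k two) ∘ₗ (aeval (b k)).toLinearMap

theorem loopPoly_apply (f : k[X]) : loopPoly k f = aeval (b k) f * idem k two := rfl

theorem loopPoly_one : loopPoly k 1 = idem k two := by
  rw [loopPoly_apply, map_one, one_mul]

theorem loopPoly_X_mul (f : k[X]) : loopPoly k (X * f) = b k * loopPoly k f := by
  rw [loopPoly_apply, loopPoly_apply, map_mul, aeval_X, mul_assoc]

theorem commute_idem_aeval (f : k[X]) : Commute (idem k two) (aeval (b k) f) := by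
  have h : Commute (idem k two) (b k) := by
    rw [commute_iff_eq, b, ofArrow_mul_idem, idem_mul_ofArrow]
  induction f using Polynomial.induction_on' with
  | add p q hp hq => rw [map_add]; exact hp.add_right hq
  | monomial n r =>
    rw [aeval_monomial]
    exact Commute.mul_right (Algebra.commutes r (idem k two)).symm (h.pow_right n)

theorem idem_mul_loopPoly (f : k[X]) : idem k two * loopPoly k f = loopPoly k f := by
  rw [loopPoly_apply, ← mul_assoc, (commute_idem_aeval k f).eq, mul_assoc, idem_mul_idem]

theorem loopPoly_mul_idem (f : k[X]) : loopPoly k f * idem k two = loopPoly k f := by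
  rw [loopPoly_apply, mul_assoc, idem_mul_idem]

theorem loopPoly_mul (f g : k[X]) : loopPoly k (f * g) = loopPoly k f * loopPoly k g := by
  rw [loopPoly_apply k f, mul_assoc, idem_mul_loopPoly, loopPoly_apply, loopPoly_apply, map_mul,
    mul_assoc]

theorem loopPoly_X : loopPoly k X = b k := by
  rw [loopPoly_apply, aeval_X, b, ofArrow_mul_idem, if_pos rfl]

theorem loopPoly_X_pow_succ (n : ℕ) : loopPoly k (X ^ (n + 1)) = b k ^ (n + 1) := by
  rw [loopPoly_apply, map_pow, aeval_X, pow_succ, mul_assoc, ← loopPoly_X, loopPoly_mul_idem]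

theorem toMatrix_loopPoly (f : k[X]) : toMatrix k (loopPoly k f) = Matrix.single two two f := by
  have h : ∀ n : ℕ, toMatrix k (loopPoly k (X ^ n)) = Matrix.single two two (X ^ n) := fun n => by
    induction n with
    | zero => rw [pow_zero, loopPoly_one, toMatrix_idem]
    | succ n ih => rw [pow_succ', loopPoly_X_mul, map_mul, ih, toMatrix_b,
        Matrix.single_mul_single_same]
  induction f using Polynomial.induction_on' with
  | add p q hp hq => rw [map_add, map_add, hp, hq, Matrix.single_add]
  | monomial n r =>
    rw [← C_mul_X_pow_eq_monomial, ← smul_eq_C_mul, map_smul, map_smul, h, Matrix.smul_single]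

/-- The element of the path algebra with a given matrix entry. -/
def entry : LoopVertex → LoopVertex → k[X] →ₗ[k] PathAlgebra k LoopVertex
  | one, one => (lcoeff k 0).smulRight (idem k one)
  | two, two => loopPoly k
  | three, three => (lcoeff k 0).smulRight (idem k three)
  | one, two => LinearMap.mulLeft k (a k) ∘ₗ loopPoly k
  | two, three => LinearMap.mulRight k (c k) ∘ₗ loopPoly k
  | one, three => LinearMap.mulLeft k (a k) ∘ₗ LinearMap.mulRight k (c k) ∘ₗ loopPoly k
  | _, _ => 0

theorem entry_one_one (f : k[X]) : entry k one one f = f.coeff 0 • idem k one := rfl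
theorem entry_three_three (f : k[X]) : entry k three three f = f.coeff 0 • idem k three := rfl
theorem entry_two_two (f : k[X]) : entry k two two f = loopPoly k f := rfl
theorem entry_one_two (f : k[X]) : entry k one two f = a k * loopPoly k f := rfl
theorem entry_two_three (f : k[X]) : entry k two three f = loopPoly k f * c k := rfl
theorem entry_one_three (f : k[X]) : entry k one three f = a k * (loopPoly k f * c k) := rfl

theorem toMatrix_entry_one_two (f : k[X]) :
    toMatrix k (entry k one two f) = Matrix.single one two f := by
  simp [entry_one_two, toMatrix_a, toMatrix_loopPoly]

theorem toMatrix_entry_two_three (f : k[X]) :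
    toMatrix k (entry k two three f) = Matrix.single two three f := by
  simp [entry_two_three, toMatrix_c, toMatrix_loopPoly]

theorem toMatrix_entry_one_three (f : k[X]) :
    toMatrix k (entry k one three f) = Matrix.single one three f := by
  simp [entry_one_three, toMatrix_a, toMatrix_c, toMatrix_loopPoly]

/-- The element of the path algebra assembled from the entries of a matrix. -/
def ofMatrix : Matrix LoopVertex LoopVertex k[X] →ₗ[k] PathAlgebra k LoopVertex where
  toFun M := ∑ i, ∑ j, entry k i j (M i j)
  map_add' M N := by simp only [Matrix.add_apply, map_add, Finset.sum_add_distrib]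
  map_smul' r M := by simp only [Matrix.smul_apply, map_smul, Finset.smul_sum, RingHom.id_apply]

theorem ofMatrix_single (i j : LoopVertex) (f : k[X]) :
    ofMatrix k (Matrix.single i j f) = entry k i j f := by
  change ∑ i', ∑ j', entry k i' j' (Matrix.single i j f i' j') = _
  rw [Finset.sum_eq_single i, Finset.sum_eq_single j, Matrix.single_apply_same]
  · intro j' _ h
    rw [Matrix.single_apply_of_col_ne _ _ h.symm, map_zero]
  · simp
  · intro i' _ h
    exact Finset.sum_eq_zero fun j' _ => by
      rw [Matrix.single_apply_of_row_ne h.symm, map_zero]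
  · simp

/-- The vertices in the order in which paths visit them. -/
def rank : LoopVertex → ℕ
  | three => 0
  | two => 1
  | one => 2

/-- A path is determined by its ends and its number of loops. The first two clauses serve the
induction: they exclude paths going backwards and nontrivial closed paths at vertices 1 and 3. -/
theorem path_aux {x : LoopVertex} : ∀ {y : LoopVertex} (p : Quiver.Path x y),
    rank x ≤ rank y ∧ (x = y → x ≠ two → pathDegree p = 0) ∧
      entry k y x (X ^ pathDegree p) = ofPath k ⟨x, y, p⟩
  | _, .nil => by
    refine ⟨le_rfl, fun _ _ => rfl, ?_⟩
    change entry k x x 1 = idem k x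
    cases x
    · simp [entry_one_one]
    · rw [entry_two_two, loopPoly_one]
    · simp [entry_three_three]
  | y, .cons (b := z) p s => by
    obtain ⟨h1, h2, h3⟩ := path_aux p
    have h4 : ofPath k ⟨x, y, p.cons s⟩ = ofArrow k s * ofPath k ⟨x, z, p⟩ := by
      rw [ofArrow, ofPath_mul_ofPath]
      simp [pathMul, Quiver.Hom.toPath]
    rw [h4, ← h3]
    change LoopArrow z y at s
    cases s <;> cases x <;> simp only [rank] at h1 <;> try omega
    all_goals refine ⟨by simp [rank], by simp, ?_⟩
    all_goals simp only [pathDegree, arrowDegree, add_zero, pow_succ']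
    · rfl
    · rfl
    · exact loopPoly_X_mul k _
    · rw [entry_two_three, entry_two_three, loopPoly_X_mul, mul_assoc]
      rfl
    · rw [h2 rfl (by simp), pow_zero, entry_two_three, entry_three_three, loopPoly_one]
      change idem k two * ofArrow k LoopArrow.γ = ofArrow k LoopArrow.γ * _
      rw [idem_mul_ofArrow, if_pos rfl, coeff_one_zero, one_smul, ofArrow_mul_idem, if_pos rfl]

theorem ofMatrix_toMatrix (f : PathAlgebra k LoopVertex) : ofMatrix k (toMatrix k f) = f := by
  have key : ofMatrix k ∘ₗ (toMatrix k).toLinearMap = LinearMap.id := hom_ext fun p => by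
    change ofMatrix k (toMatrix k (ofPath k p)) = ofPath k p
    rw [toMatrix_ofPath, ofMatrix_single]
    exact (path_aux k p.path).2.2
  exact congrArg (fun G => G f) key

theorem toMatrix_injective : Function.Injective (toMatrix k) :=
  Function.LeftInverse.injective (ofMatrix_toMatrix k)

/-- Cutting by vertex idempotents isolates a matrix entry; hence a two-sided ideal can be studied
entry by entry. -/
theorem idem_mul_mul_idem (f : PathAlgebra k LoopVertex) (i j : LoopVertex) :
    idem k i * f * idem k j = entry k i j (toMatrix k f i j) := by
  rw [← ofMatrix_toMatrix k (idem k i * f * idem k j), ← ofMatrix_single]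
  congr 1
  rw [map_mul, map_mul, toMatrix_idem, toMatrix_idem, Matrix.single_mul_mul_single, one_mul,
    mul_one]

/-- The matrices that come from elements of the path algebra. -/
def IsPathMatrix (M : Matrix LoopVertex LoopVertex k[X]) : Prop :=
  M one one = C ((M one one).coeff 0) ∧ M three three = C ((M three three).coeff 0) ∧
    M two one = 0 ∧ M three one = 0 ∧ M three two = 0

theorem toMatrix_ofMatrix_eq (M : Matrix LoopVertex LoopVertex k[X]) :
    toMatrix k (ofMatrix k M) = Matrix.single one one (C ((M one one).coeff 0)) +
      Matrix.single one two (M one two) + Matrix.single one three (M one three) +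
      Matrix.single two two (M two two) + Matrix.single two three (M two three) +
      Matrix.single three three (C ((M three three).coeff 0)) := by
  have h0 : ∀ f, entry k two one f = 0 ∧ entry k three one f = 0 ∧ entry k three two f = 0 :=
    fun f => ⟨rfl, rfl, rfl⟩
  change toMatrix k (∑ i, ∑ j, entry k i j (M i j)) = _
  simp only [sum_vertices, map_add, toMatrix_entry_one_two, toMatrix_entry_two_three,
    toMatrix_entry_one_three, entry_two_two, toMatrix_loopPoly, h0, map_zero]
  rw [entry_one_one, entry_three_three, map_smul, map_smul, toMatrix_idem, toMatrix_idem,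
    Matrix.smul_single, Matrix.smul_single, smul_eq_C_mul, smul_eq_C_mul, mul_one, mul_one]
  abel

theorem isPathMatrix_toMatrix (f : PathAlgebra k LoopVertex) :
    IsPathMatrix k (toMatrix k f) := by
  rw [← ofMatrix_toMatrix k f, toMatrix_ofMatrix_eq]
  refine ⟨?_, ?_, ?_, ?_, ?_⟩ <;> simp

theorem toMatrix_ofMatrix {M : Matrix LoopVertex LoopVertex k[X]} (hM : IsPathMatrix k M) :
    toMatrix k (ofMatrix k M) = M := by
  obtain ⟨h11, h33, h21, h31, h32⟩ := hM
  rw [toMatrix_ofMatrix_eq, ← h11, ← h33]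
  ext i j : 2
  cases i <;> cases j <;> simp [h21, h31, h32]

end LoopQuiver
end

/-! ### Derivations of quotients of the path algebra -/

theorem exists_derivation_of_surjective {k : Type u} [Field k] {R : Type v} [Ring R] [Algebra k R]
    {B : Type w} [Ring B] [Algebra k B] {π : R →ₐ[k] B} (hπ : Function.Surjective π)
    {D : R →ₗ[k] R} (hD : D ∈ derivationSpace k R) (hker : ∀ x, π x = 0 → π (D x) = 0) :
    ∃ E : derivationSpace k B, ∀ x, E.1 (π x) = π (D x) := by
  have hD' : ∀ x y, D (x * y) = D x * y + x * D y := hD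
  let F : B →ₗ[k] B := (LinearMap.ker π.toLinearMap).liftQ (π.toLinearMap ∘ₗ D) hker ∘ₗ
    (π.toLinearMap.quotKerEquivOfSurjective hπ).symm.toLinearMap
  have hF : ∀ x, F (π x) = π (D x) := fun x => by
    have h : (π.toLinearMap.quotKerEquivOfSurjective hπ).symm (π x) =
        Submodule.Quotient.mk x := (LinearEquiv.symm_apply_eq _).2 rfl
    change (LinearMap.ker π.toLinearMap).liftQ (π.toLinearMap ∘ₗ D) hker
      ((π.toLinearMap.quotKerEquivOfSurjective hπ).symm (π x)) = _
    rw [h]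
    rfl
  refine ⟨⟨F, fun x y => ?_⟩, hF⟩
  obtain ⟨x, rfl⟩ := hπ x
  obtain ⟨y, rfl⟩ := hπ y
  rw [← map_mul, hF, hF, hF, hD', map_add, map_mul, map_mul]

namespace LoopQuiver

open PathAlgebra Polynomial LoopVertex

noncomputable section

variable (k : Type u) [Field k]

/-- The function on the vertices with value `s` at the first one and zero elsewhere. -/
def weight (s : k[X]) : LoopVertex → k[X]
  | one => s
  | _ => 0

/-- The derivation `p d/dx + [diag(s, 0, 0), -]` of the matrix algebra. -/
def matrixDer (p s : k[X]) :
    Matrix LoopVertex LoopVertex k[X] →ₗ[k] Matrix LoopVertex LoopVertex k[X] where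
  toFun M := Matrix.of fun i j =>
    p * derivative (M i j) + (weight k s i - weight k s j) * M i j
  map_add' M N := by
    refine Matrix.ext fun i j => ?_
    simp only [Matrix.add_apply, Matrix.of_apply, derivative_add]
    ring
  map_smul' r M := by
    refine Matrix.ext fun i j => ?_
    simp

theorem matrixDer_apply (p s : k[X]) (M : Matrix LoopVertex LoopVertex k[X]) (i j : LoopVertex) :
    matrixDer k p s M i j = p * derivative (M i j) + (weight k s i - weight k s j) * M i j := rfl

theorem matrixDer_mul (p s : k[X]) (M N : Matrix LoopVertex LoopVertex k[X]) :
    matrixDer k p s (M * N) = matrixDer k p s M * N + M * matrixDer k p s N := by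
  refine Matrix.ext fun i j => ?_
  simp only [matrixDer_apply, Matrix.add_apply, Matrix.mul_apply, derivative_sum, derivative_mul,
    Finset.mul_sum, ← Finset.sum_add_distrib]
  exact Finset.sum_congr rfl fun l _ => by ring

theorem IsPathMatrix.matrixDer {M : Matrix LoopVertex LoopVertex k[X]} (hM : IsPathMatrix k M)
    (p s : k[X]) : IsPathMatrix k (matrixDer k p s M) := by
  obtain ⟨h11, h33, h21, h31, h32⟩ := hM
  refine ⟨?_, ?_, ?_, ?_, ?_⟩ <;> rw [matrixDer_apply]
  · rw [h11]; simp
  · rw [h33]; simp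
  · simp [h21]
  · simp [h31]
  · simp [h32]

/-- The derivation of the path algebra corresponding to `matrixDer`. -/
def pathDer (p s : k[X]) : PathAlgebra k LoopVertex →ₗ[k] PathAlgebra k LoopVertex :=
  ofMatrix k ∘ₗ matrixDer k p s ∘ₗ (toMatrix k).toLinearMap

theorem toMatrix_pathDer (p s : k[X]) (f : PathAlgebra k LoopVertex) :
    toMatrix k (pathDer k p s f) = matrixDer k p s (toMatrix k f) :=
  toMatrix_ofMatrix k ((isPathMatrix_toMatrix k f).matrixDer k p s)

theorem pathDer_mem (p s : k[X]) :
    pathDer k p s ∈ derivationSpace k (PathAlgebra k LoopVertex) := fun f g => by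
  apply toMatrix_injective k
  simp only [map_add, map_mul, toMatrix_pathDer, matrixDer_mul]

variable {k} {B : Type v} [Ring B] [Algebra k B] (π : PathAlgebra k LoopVertex →ₐ[k] B)

theorem map_entry_eq_zero {f : PathAlgebra k LoopVertex} (hf : π f = 0) (i j : LoopVertex) :
    π (entry k i j (toMatrix k f i j)) = 0 := by
  rw [← idem_mul_mul_idem, map_mul, map_mul, hf, mul_zero, zero_mul]

/-- A quotient of the path algebra inherits a noninner derivation from the path algebra if its
kernel is stable in each matrix entry. -/
theorem exists_derivation_notMem_range (hπ : Function.Surjective π) (p s : k[X])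
    (hp0 : p.coeff 0 = 0) (hp : π (entry k two two p) ≠ 0)
    (h22 : ∀ f, π (entry k two two f) = 0 → π (entry k two two (p * derivative f)) = 0)
    (h12 : ∀ f, π (entry k one two f) = 0 → π (entry k one two (p * derivative f + s * f)) = 0)
    (h23 : ∀ f, π (entry k two three f) = 0 → π (entry k two three (p * derivative f)) = 0)
    (h13 : ∀ f, π (entry k one three f) = 0 →
      π (entry k one three (p * derivative f + s * f)) = 0) :
    ∃ D : derivationSpace k B, D ∉ LinearMap.range (innerDerivation k B) := by
  obtain ⟨E, hE⟩ := exists_derivation_of_surjective hπ (pathDer_mem k p s) fun f hf => by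
    have h := map_entry_eq_zero π hf
    change π (∑ i, ∑ j, entry k i j (matrixDer k p s (toMatrix k f) i j)) = 0
    rw [map_sum]
    refine Finset.sum_eq_zero fun i _ => ?_
    rw [map_sum]
    refine Finset.sum_eq_zero fun j _ => ?_
    rw [matrixDer_apply]
    cases i <;> cases j <;> simp only [weight, sub_self, sub_zero, zero_mul, add_zero]
    · simp [entry_one_one, mul_coeff_zero, hp0]
    · exact h12 _ (h one two)
    · exact h13 _ (h one three)
    · exact map_zero π
    · exact h22 _ (h two two)
    · exact h23 _ (h two three)
    · exact map_zero π
    · exact map_zero π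
    · simp [entry_three_three, mul_coeff_zero, hp0]
  refine ⟨E, fun ⟨y, hy⟩ => hp ?_⟩
  obtain ⟨z, rfl⟩ := hπ y
  have h1 : π z * π (b k) - π (b k) * π z = E.1 (π (b k)) :=
    LinearMap.congr_fun (congrArg Subtype.val hy) (π (b k))
  rw [hE] at h1
  have h2 : π (pathDer k p s (b k) - (z * b k - b k * z)) = 0 := by
    rw [map_sub, map_sub, map_mul, map_mul, h1, sub_self]
  have h3 := map_entry_eq_zero π h2 two two
  -- The matrix of β has the single entry x at (2,2), so every commutator with it vanishes there,
  -- while the derivation yields p · x' = p.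
  have h4 : toMatrix k (pathDer k p s (b k) - (z * b k - b k * z)) two two = p := by
    simp only [map_sub, map_mul, toMatrix_pathDer, toMatrix_b, Matrix.sub_apply, matrixDer_apply]
    simp [mul_comm]
  rwa [h4] at h3

/-! ### The entries of the kernel -/

theorem entry_two_two_mul (f g : k[X]) :
    entry k two two (f * g) = loopPoly k f * entry k two two g := loopPoly_mul k f g

theorem entry_one_two_mul (f g : k[X]) :
    entry k one two (f * g) = entry k one two g * loopPoly k f := by
  rw [entry_one_two, entry_one_two, mul_comm, loopPoly_mul, mul_assoc]

theorem entry_two_three_mul (f g : k[X]) :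
    entry k two three (f * g) = loopPoly k f * entry k two three g := by
  rw [entry_two_three, entry_two_three, loopPoly_mul, mul_assoc]

/-- The polynomials whose `(2,2)` entry is killed. -/
def ker22 : Ideal k[X] where
  carrier := {f | π (entry k two two f) = 0}
  add_mem' {f g} (hf : _ = _) (hg : _ = _) := by
    change π (entry k two two (f + g)) = 0
    rw [map_add, map_add, hf, hg, add_zero]
  zero_mem' := by simp
  smul_mem' f g (hg : _ = _) := by
    change π (entry k two two (f * g)) = 0
    rw [entry_two_two_mul, map_mul, hg, mul_zero]

/-- The polynomials whose `(1,2)` entry is killed. -/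
def ker12 : Ideal k[X] where
  carrier := {f | π (entry k one two f) = 0}
  add_mem' {f g} (hf : _ = _) (hg : _ = _) := by
    change π (entry k one two (f + g)) = 0
    rw [map_add, map_add, hf, hg, add_zero]
  zero_mem' := by simp
  smul_mem' f g (hg : _ = _) := by
    change π (entry k one two (f * g)) = 0
    rw [entry_one_two_mul, map_mul, hg, zero_mul]

/-- The polynomials whose `(2,3)` entry is killed. -/
def ker23 : Ideal k[X] where
  carrier := {f | π (entry k two three f) = 0}
  add_mem' {f g} (hf : _ = _) (hg : _ = _) := by
    change π (entry k two three (f + g)) = 0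
    rw [map_add, map_add, hf, hg, add_zero]
  zero_mem' := by simp
  smul_mem' f g (hg : _ = _) := by
    change π (entry k two three (f * g)) = 0
    rw [entry_two_three_mul, map_mul, hg, mul_zero]

/-- The polynomials whose `(1,3)` entry is killed. -/
def ker13 : Submodule k k[X] := LinearMap.ker (π.toLinearMap ∘ₗ entry k one three)

theorem mem_ker22 {f : k[X]} : f ∈ ker22 π ↔ π (entry k two two f) = 0 := Iff.rfl
theorem mem_ker12 {f : k[X]} : f ∈ ker12 π ↔ π (entry k one two f) = 0 := Iff.rfl
theorem mem_ker23 {f : k[X]} : f ∈ ker23 π ↔ π (entry k two three f) = 0 := Iff.rfl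
theorem mem_ker13 {f : k[X]} : f ∈ ker13 π ↔ π (entry k one three f) = 0 := Iff.rfl

theorem ker22_le_ker12 : ker22 π ≤ ker12 π := fun f hf => by
  rw [mem_ker22, entry_two_two] at hf
  rw [mem_ker12, entry_one_two, map_mul, hf, mul_zero]

theorem ker22_le_ker23 : ker22 π ≤ ker23 π := fun f hf => by
  rw [mem_ker22, entry_two_two] at hf
  rw [mem_ker23, entry_two_three, map_mul, hf, zero_mul]

theorem mem_ker13_of_mem_ker23 {f : k[X]} (hf : f ∈ ker23 π) : f ∈ ker13 π := by
  rw [mem_ker23, entry_two_three] at hf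
  rw [mem_ker13, entry_one_three, map_mul, hf, mul_zero]

/-! ### Polynomials -/

theorem exists_eq_span_X_pow {V : Ideal k[X]} {N : ℕ} (hN : X ^ N ∈ V) :
    ∃ n, V = Ideal.span {X ^ n} := by
  obtain ⟨g, rfl⟩ := (IsPrincipalIdealRing.principal V).principal
  obtain ⟨n, -, hn⟩ := (dvd_prime_pow prime_X N).1 (Ideal.mem_span_singleton.1 hN)
  exact ⟨n, Ideal.span_singleton_eq_span_singleton.2 hn⟩

/-- Such an ideal is (x^n), and x d/dx multiplies x^n by n. -/
theorem X_mul_derivative_mem {V : Ideal k[X]} {N : ℕ} (hN : X ^ N ∈ V) {f : k[X]} (hf : f ∈ V) :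
    X * derivative f ∈ V := by
  obtain ⟨n, rfl⟩ := exists_eq_span_X_pow hN
  obtain ⟨g, rfl⟩ := Ideal.mem_span_singleton.1 hf
  refine Ideal.mem_span_singleton.2 ⟨C (n : k) * g + X * derivative g, ?_⟩
  rw [derivative_mul, derivative_X_pow]
  cases n with
  | zero => simp
  | succ n => rw [Nat.add_sub_cancel]; ring

theorem exists_eq_two_terms (f : k[X]) :
    ∃ h, f = C (f.coeff 0) + C (f.coeff 1) * X + X ^ 2 * h := by
  refine ⟨f.divX.divX, ?_⟩
  have h1 := divX_mul_X_add f
  have h2 := divX_mul_X_add f.divX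
  rw [coeff_divX] at h2
  linear_combination - h1 - X * h2

theorem exists_eq_three_terms (f : k[X]) :
    ∃ h, f = C (f.coeff 0) + C (f.coeff 1) * X + C (f.coeff 2) * X ^ 2 + X ^ 3 * h := by
  refine ⟨f.divX.divX.divX, ?_⟩
  have h1 := divX_mul_X_add f
  have h2 := divX_mul_X_add f.divX
  have h3 := divX_mul_X_add f.divX.divX
  rw [coeff_divX] at h2
  rw [coeff_divX, coeff_divX] at h3
  linear_combination - h1 - X * h2 - X ^ 2 * h3

/-- A subspace containing `x^n k[x]` is stable under a first order differential operator
`p d/dx + s` with `p` divisible by `x`, but not by `x^n`, if it contains `x^(n-1)` or `n ≤ 3`. -/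
theorem exists_differential_operator (W : Submodule k k[X]) {n : ℕ} (hn : 2 ≤ n)
    (hW : ∀ h, X ^ n * h ∈ W) (hW' : n ≤ 3 ∨ X ^ (n - 1) ∈ W) :
    ∃ p s : k[X], X ∣ p ∧ ¬ X ^ n ∣ p ∧ ∀ f ∈ W, p * derivative f + s * f ∈ W := by
  have hC : ∀ (r : k) {f : k[X]}, f ∈ W → C r * f ∈ W := fun r f hf => by
    rw [← smul_eq_C_mul]
    exact W.smul_mem r hf
  have hX : ∀ m < n, ¬ (X : k[X]) ^ n ∣ X ^ m := fun m hm h =>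
    absurd ((pow_dvd_pow_iff X_ne_zero not_isUnit_X).1 h) (by omega)
  have hXC : ∀ (r : k) (m : ℕ), r ≠ 0 → C r * X ^ m ∈ W → X ^ m ∈ W := fun r m hr h => by
    have := hC r⁻¹ h
    rwa [← mul_assoc, ← C_mul, inv_mul_cancel₀ hr, C_1, one_mul] at this
  -- With p = x^(n-1) and s = 0, the image of f is f₁ x^(n-1) modulo x^n, where fᵢ is the
  -- coefficient of x^i.
  by_cases htop : X ^ (n - 1) ∈ W ∨ ∀ f ∈ W, f.coeff 1 = 0
  · refine ⟨X ^ (n - 1), 0, dvd_pow_self X (by omega), hX _ (by omega), fun f hf => ?_⟩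
    obtain ⟨h, hh⟩ := exists_eq_two_terms f
    obtain ⟨m, rfl⟩ : ∃ m, n = m + 2 := ⟨n - 2, by omega⟩
    have h1 : X ^ (m + 2 - 1) * derivative f + 0 * f = C (f.coeff 1) * X ^ (m + 2 - 1) +
        X ^ (m + 2) * (C 2 * h + X * derivative h) := by
      rw [hh]
      simp only [derivative_add, derivative_C, derivative_X, derivative_mul,
        derivative_X_sq, coeff_add, Nat.add_succ_sub_one]
      simp only [coeff_C_succ, coeff_C_mul, coeff_X_one, coeff_X_pow_mul', zero_add]
      simp
      ring
    rw [h1]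
    refine W.add_mem ?_ (hW _)
    rcases htop with ht | ht
    · exact hC _ ht
    · rw [ht f hf]; simp
  · push Not at htop
    obtain ⟨htop, f, hf, hf1⟩ := htop
    have hn3 : n ≤ 3 := hW'.resolve_right htop
    obtain rfl | rfl : n = 2 ∨ n = 3 := by omega
    · have htrunc : ∀ g ∈ W, C (g.coeff 0) + C (g.coeff 1) * X ∈ W := fun g hg => by
        obtain ⟨h, hh⟩ := exists_eq_two_terms g
        rw [eq_sub_of_add_eq hh.symm]
        exact W.sub_mem hg (hW h)
      have h0 : f.coeff 0 ≠ 0 := fun h0 => htop (by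
        have := htrunc f hf
        rw [h0, C_0, zero_add, ← pow_one X] at this
        exact hXC _ _ hf1 this)
      -- Modulo x², W is the line spanned by f₀ + f₁x; otherwise it would contain x. So s =
      -- -(f₁/f₀)x makes x d/dx + s vanish on it.
      have hprop : ∀ g ∈ W, g.coeff 1 * f.coeff 0 - f.coeff 1 * g.coeff 0 = 0 := fun g hg => by
        by_contra hne
        have h1 : C (g.coeff 1 * f.coeff 0 - f.coeff 1 * g.coeff 0) * X ^ 0 ∈ W := by
          have := W.sub_mem (hC (g.coeff 1) (htrunc f hf)) (hC (f.coeff 1) (htrunc g hg))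
          convert this using 1
          simp only [C_sub, C_mul]
          ring
        have h2 : C (f.coeff 1) * X ^ 1 ∈ W := by
          have := W.sub_mem (htrunc f hf) (hC (f.coeff 0) (hXC _ _ hne h1))
          convert this using 1
          ring
        exact htop (hXC _ _ hf1 h2)
      refine ⟨X, C (-f.coeff 1 / f.coeff 0) * X, dvd_rfl, by simpa using hX 1 (by omega),
        fun g hg => ?_⟩
      obtain ⟨h, hh⟩ := exists_eq_two_terms g
      have h1 : g.coeff 1 + (-f.coeff 1 / f.coeff 0) * g.coeff 0 = 0 := by
        have := hprop g hg
        field_simp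
        linear_combination this
      have h2 : C (g.coeff 1) + C (-f.coeff 1 / f.coeff 0) * C (g.coeff 0) = 0 := by
        rw [← C_mul, ← C_add, h1, C_0]
      generalize -f.coeff 1 / f.coeff 0 = t at h1 h2
      have h3 : X * derivative g + C t * X * g = X ^ 2 * (2 * h + X * derivative h +
          C t * C (g.coeff 1) + C t * X * h) := by
        have hd : derivative g = C (g.coeff 1) + 2 * X * h + X ^ 2 * derivative h := by
          conv_lhs => rw [hh]
          simp
          ring
        linear_combination X * hd + C t * X * hh + X * h2
      rw [h3]
      exact hW _
    · have htrunc : ∀ g ∈ W, C (g.coeff 0) + C (g.coeff 1) * X + C (g.coeff 2) * X ^ 2 ∈ W :=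
        fun g hg => by
          obtain ⟨h, hh⟩ := exists_eq_three_terms g
          rw [eq_sub_of_add_eq hh.symm]
          exact W.sub_mem hg (hW h)
      -- For n = 3 take p = x² and s = ux + vx²; the displayed polynomial is the image of g modulo
      -- x³. It remains to choose u and v.
      have key : ∀ u v : k, (∀ g ∈ W, C (u * g.coeff 0) * X +
          C (g.coeff 1 + u * g.coeff 1 + v * g.coeff 0) * X ^ 2 ∈ W) →
          ∃ p s : k[X], X ∣ p ∧ ¬ X ^ 3 ∣ p ∧ ∀ f ∈ W, p * derivative f + s * f ∈ W :=
        fun u v huv => by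
          refine ⟨X ^ 2, C u * X + C v * X ^ 2, dvd_pow_self X two_ne_zero, hX 2 (by omega),
            fun g hg => ?_⟩
          obtain ⟨h, hh⟩ := exists_eq_three_terms g
          have hd : derivative g = C (g.coeff 1) + 2 * C (g.coeff 2) * X + 3 * X ^ 2 * h +
              X ^ 3 * derivative h := by
            conv_lhs => rw [hh]
            simp
            linear_combination X ^ 2 * h * (map_ofNat C 2 : (C 2 : k[X]) = 2)
          have h1 : X ^ 2 * derivative g + (C u * X + C v * X ^ 2) * g =
              (C (u * g.coeff 0) * X + C (g.coeff 1 + u * g.coeff 1 + v * g.coeff 0) * X ^ 2) +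
              X ^ 3 * (2 * C (g.coeff 2) + 3 * X * h + X ^ 2 * derivative h +
                C u * C (g.coeff 2) + C v * C (g.coeff 1) + C v * C (g.coeff 2) * X +
                C u * X * h + C v * X ^ 2 * h) := by
            simp only [C_mul, C_add]
            linear_combination X ^ 2 * hd + (C u * X + C v * X ^ 2) * hh
          rw [h1]
          exact W.add_mem (huv g hg) (hW _)
      by_cases h0 : ∀ g ∈ W, g.coeff 0 = 0
      · refine key (-1) 0 fun g hg => ?_
        simp [h0 g hg]
      push Not at h0
      obtain ⟨e, he, he0⟩ := h0
      by_cases h1 : ∀ g ∈ W, e.coeff 0 * g.coeff 1 - g.coeff 0 * e.coeff 1 = 0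
      · refine key 0 (-e.coeff 1 / e.coeff 0) fun g hg => ?_
        have h2 : g.coeff 1 + 0 * g.coeff 1 + (-e.coeff 1 / e.coeff 0) * g.coeff 0 = 0 := by
          field_simp
          linear_combination h1 g hg
        rw [h2]
        simp
      · push Not at h1
        obtain ⟨g, hg, hne⟩ := h1
        have h2 := W.sub_mem (hC (e.coeff 0) (htrunc g hg)) (hC (g.coeff 0) (htrunc e he))
        set r := e.coeff 0 * g.coeff 1 - g.coeff 0 * e.coeff 1 with hr
        set t := e.coeff 0 * g.coeff 2 - g.coeff 0 * e.coeff 2 with ht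
        have h3 : C r * X + C t * X ^ 2 ∈ W := by
          convert h2 using 1
          simp only [hr, ht, C_sub, C_mul]
          ring
        -- W contains rx + tx² with r ≠ 0. This choice cancels w₁ and makes the image of w the
        -- multiple -w₀/r of that element.
        refine key (-1) (-t / r) fun w hw => ?_
        have h4 := hC (-w.coeff 0 / r) h3
        convert h4 using 1
        have h5 : -w.coeff 0 / r * r = -1 * w.coeff 0 := by field_simp
        have h6 : -w.coeff 0 / r * t = w.coeff 1 + -1 * w.coeff 1 + -t / r * w.coeff 0 := by
          field_simp
          ring
        rw [← h5, ← h6, C_mul, C_mul]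
        ring

end

end LoopQuiver

/-! ### The dichotomy, and a family of nilpotent operators with a subspace -/

namespace LoopQuiver

open PathAlgebra Polynomial LoopVertex

noncomputable section

variable {k : Type u} [Field k]

/-- Either a quotient of the path algebra has a noninner derivation, or its middle vertex carries
a large truncated polynomial ring, which acts with the same nilpotency on the arrow `γ`. -/
theorem exists_derivation_or_X_pow_dvd {B : Type v} [Ring B] [Algebra k B]
    {π : PathAlgebra k LoopVertex →ₐ[k] B} (hπ : Function.Surjective π)
    (h2 : ∀ f ∈ ker22 π, X ^ 2 ∣ f) {N : ℕ} (hN : X ^ N ∈ ker22 π) :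
    (∃ D : derivationSpace k B, D ∉ LinearMap.range (innerDerivation k B)) ∨
      (∀ f ∈ ker22 π, X ^ 4 ∣ f) ∧ ∀ f ∈ ker23 π, X ^ 4 ∣ f := by
  obtain ⟨n, hn⟩ := exists_eq_span_X_pow hN
  have hmem : ∀ {f}, f ∈ ker22 π ↔ X ^ n ∣ f := by rw [hn]; exact Ideal.mem_span_singleton
  have hn2 : 2 ≤ n := (pow_dvd_pow_iff X_ne_zero not_isUnit_X).1 (h2 _ (hmem.2 dvd_rfl))
  by_cases hW' : n ≤ 3 ∨ X ^ (n - 1) ∈ ker13 π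
  · left
    obtain ⟨p, s, ⟨q, rfl⟩, hpn, hps⟩ := exists_differential_operator (ker13 π) hn2
      (fun h => mem_ker13_of_mem_ker23 π (ker22_le_ker23 π (hmem.2 (dvd_mul_right _ h)))) hW'
    have hder : ∀ {V : Ideal k[X]}, ker22 π ≤ V → ∀ f ∈ V, X * q * derivative f ∈ V :=
      fun hV f hf => by
        have := Ideal.mul_mem_left _ q (X_mul_derivative_mem (hV hN) hf)
        rwa [← mul_assoc, mul_comm q] at this
    exact exists_derivation_notMem_range π hπ (X * q) s (by simp)
      (fun h => hpn (hmem.1 h)) (hder le_rfl)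
      (fun f hf => Ideal.add_mem _ (hder (ker22_le_ker12 π) f hf) (Ideal.mul_mem_left _ s hf))
      (hder (ker22_le_ker23 π)) hps
  · right
    push Not at hW'
    have h4 : (X : k[X]) ^ 4 ∣ X ^ n := pow_dvd_pow X (by omega)
    refine ⟨fun f hf => h4.trans (hmem.1 hf), fun f hf => ?_⟩
    obtain ⟨a, ha⟩ := exists_eq_span_X_pow (ker22_le_ker23 π hN)
    -- If a < n, then x^(n-1) would lie in the (2,3) ideal, hence in the (1,3) subspace.
    have han : n ≤ a := by
      by_contra hlt
      refine hW'.2 (mem_ker13_of_mem_ker23 π ?_)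
      rw [ha, Ideal.mem_span_singleton]
      exact pow_dvd_pow X (by omega)
    rw [ha, Ideal.mem_span_singleton] at hf
    exact (h4.trans (pow_dvd_pow X han)).trans hf

/-- The representation of the path algebra given by an endomorphism of `V` and a linear map
`U → V`, with the zero space at the first vertex. -/
def rep {V : Type v} {U : Type w} [AddCommGroup V] [Module k V] [AddCommGroup U] [Module k U]
    (T : Module.End k V) (g : U →ₗ[k] V) :
    PathAlgebra k LoopVertex →ₐ[k] Module.End k (V × U) :=
  let F : PathAlgebra k LoopVertex →ₗ[k] Module.End k (V × U) :=
    { toFun := fun f =>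
        ((aeval T (toMatrix k f two two)).coprod (aeval T (toMatrix k f two three) ∘ₗ g)).prod
          ((toMatrix k f three three).coeff 0 • LinearMap.snd k V U)
      map_add' := fun f f' => by
        ext y <;> simp [add_smul]
      map_smul' := fun r f => by
        ext y <;> simp [mul_smul] }
  have hF : ∀ f y, F f y = (aeval T (toMatrix k f two two) y.1 +
      aeval T (toMatrix k f two three) (g y.2), (toMatrix k f three three).coeff 0 • y.2) :=
    fun f y => rfl
  AlgHom.ofLinearMap F
    (by
      refine LinearMap.ext fun y => ?_
      rw [hF, map_one]
      simp)
    (fun f f' => by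
      obtain ⟨-, -, h21, h31, h32⟩ := isPathMatrix_toMatrix k f
      obtain ⟨-, h33', -, -, h32'⟩ := isPathMatrix_toMatrix k f'
      refine LinearMap.ext fun y => ?_
      rw [Module.End.mul_apply, hF, hF, hF, map_mul]
      simp only [Matrix.mul_apply, sum_vertices, h21, h31, h32, h32', zero_mul, mul_zero, zero_add,
        add_zero, map_add, map_mul, LinearMap.add_apply, Module.End.mul_apply, mul_coeff_zero,
        mul_smul]
      rw [h33', aeval_C, coeff_C_zero, Module.algebraMap_end_apply, map_smul, map_smul g,
        map_smul (aeval T _), add_assoc])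

theorem rep_apply {V : Type v} {U : Type w} [AddCommGroup V] [Module k V] [AddCommGroup U]
    [Module k U] (T : Module.End k V) (g : U →ₗ[k] V) (f : PathAlgebra k LoopVertex) (y : V × U) :
    rep T g f y = (aeval T (toMatrix k f two two) y.1 +
      aeval T (toMatrix k f two three) (g y.2), (toMatrix k f three three).coeff 0 • y.2) := rfl

/-! ### A family of nilpotent operators with an invariantly embedded subspace -/

/-- The free module on which the nilpotent operator acts. -/
abbrev Space (R : Type u) : Type u := (R × R × R × R) × R × R

variable (k) {R : Type u} [CommRing R] [Algebra k R]

/-- The nilpotent operator with blocks of sizes four and two. -/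
def shift (R : Type u) [CommRing R] [Algebra k R] : Module.End k (Space R) where
  toFun y := ((0, y.1.1, y.1.2.1, y.1.2.2.1), 0, y.2.1)
  map_add' y z := by simp
  map_smul' r y := by simp

/-- The embedding of the subspace depending on a parameter. -/
def embedding (t : R) : R × R →ₗ[k] Space R where
  toFun y := ((0, y.1, y.2, 0), y.1, t * y.2)
  map_add' y z := by simp [mul_add]
  map_smul' r y := by simp

theorem shift_apply (y : Space R) :
    shift k R y = ((0, y.1.1, y.1.2.1, y.1.2.2.1), 0, y.2.1) := rfl
theorem embedding_apply (t : R) (y : R × R) :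
    embedding k t y = ((0, y.1, y.2, 0), y.1, t * y.2) := rfl

theorem shift_pow_four : shift k R ^ 4 = 0 := by
  refine LinearMap.ext fun y => ?_
  simp [pow_succ, shift_apply]

variable {k}

theorem embedding_injective (t : R) : Function.Injective (embedding k t) := fun y z h => by
  simp only [embedding_apply, Prod.mk.injEq] at h
  exact Prod.ext h.1.2.1 h.1.2.2.1

section endo

variable {t : R} {f : Module.End k (Space R)} {g : Module.End k (R × R)}

/-- The square of the shift T kills the generator of the short block, hence also its image, which
therefore avoids the top two layers of the long block. -/
theorem coord_of_b (hT : ∀ y, f (shift k R y) = shift k R (f y)) (v : R) :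
    (f ((0, 0, 0, 0), v, 0)).1.1 = 0 ∧ (f ((0, 0, 0, 0), v, 0)).1.2.1 = 0 := by
  have h1 : shift k R (shift k R (((0, 0, 0, 0), v, 0) : Space R)) = 0 := rfl
  have h2 := hT (shift k R ((0, 0, 0, 0), v, 0))
  rw [h1, hT, map_zero, shift_apply, shift_apply] at h2
  exact ⟨(congrArg (fun z : Space R => z.1.2.2.1) h2).symm,
    (congrArg (fun z : Space R => z.1.2.2.2) h2).symm⟩

/-- Neither the short block nor the image of T contributes to the top of the long block, so f
induces a map A on that top. -/
theorem coord_a_eq (hT : ∀ y, f (shift k R y) = shift k R (f y)) (y : Space R) :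
    (f y).1.1 = (f ((y.1.1, 0, 0, 0), 0, 0)).1.1 := by
  have hy : y = ((y.1.1, 0, 0, 0), 0, 0) + ((0, 0, 0, 0), y.2.1, 0) +
      shift k R ((y.1.2.1, y.1.2.2.1, y.1.2.2.2, 0), y.2.2, 0) := by
    obtain ⟨⟨a, b, c, d⟩, e, f⟩ := y
    simp [shift_apply]
  conv_lhs => rw [hy]
  rw [map_add, map_add, hT, Prod.fst_add, Prod.fst_add, Prod.fst_add, Prod.fst_add,
    (coord_of_b hT _).1]
  simp [shift_apply]

theorem coord_b_eq (hT : ∀ y, f (shift k R y) = shift k R (f y)) (y : Space R)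
    (hy : y.1.1 = 0) : (f y).2.1 = (f ((0, 0, 0, 0), y.2.1, 0)).2.1 := by
  have hy : y = ((0, 0, 0, 0), y.2.1, 0) +
      shift k R ((y.1.2.1, y.1.2.2.1, y.1.2.2.2, 0), y.2.2, 0) := by
    obtain ⟨⟨a, b, c, d⟩, e, f⟩ := y
    simp_all [shift_apply]
  conv_lhs => rw [hy]
  rw [map_add, hT]
  simp [shift_apply]

/-- The first generator of the subspace ties T of the long top to the short top, so f induces the
same map A on both tops. -/
theorem coord_b_eq_coord_a (hT : ∀ y, f (shift k R y) = shift k R (f y))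
    (hg : ∀ y, f (embedding k t y) = embedding k t (g y)) (v : R) :
    (f ((0, 0, 0, 0), v, 0)).2.1 = (f ((v, 0, 0, 0), 0, 0)).1.1 := by
  have h1 := hg (v, 0)
  have h2 : embedding k t (v, 0) = shift k R ((v, 0, 0, 0), 0, 0) + ((0, 0, 0, 0), v, 0) := by
    simp [shift_apply, embedding_apply]
  rw [h2, map_add, hT, shift_apply, embedding_apply] at h1
  have h3 : (f ((v, 0, 0, 0), 0, 0)).1.1 + (f ((0, 0, 0, 0), v, 0)).1.2.1 = (g (v, 0)).1 :=
    congrArg (fun z : Space R => z.1.2.1) h1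
  have h4 : 0 + (f ((0, 0, 0, 0), v, 0)).2.1 = (g (v, 0)).1 :=
    congrArg (fun z : Space R => z.2.1) h1
  rw [(coord_of_b hT v).2, add_zero] at h3
  rw [h3, ← h4, zero_add]

/-- The second generator ties the two tops through t, one layer lower, which forces A to commute
with t. -/
theorem coord_a_mul (hT : ∀ y, f (shift k R y) = shift k R (f y))
    (hg : ∀ y, f (embedding k t y) = embedding k t (g y)) (v : R) :
    (f ((t * v, 0, 0, 0), 0, 0)).1.1 = t * (f ((v, 0, 0, 0), 0, 0)).1.1 := by
  have h1 := hg (0, v)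
  have h2 : embedding k t (0, v) = shift k R (shift k R ((v, 0, 0, 0), 0, 0)) +
      shift k R ((0, 0, 0, 0), t * v, 0) := by
    simp [shift_apply, embedding_apply]
  rw [h2, map_add, hT, hT, hT, shift_apply, shift_apply, shift_apply, embedding_apply] at h1
  have h3 : (f ((v, 0, 0, 0), 0, 0)).1.1 + (f ((0, 0, 0, 0), t * v, 0)).1.2.1 = (g (0, v)).2 :=
    congrArg (fun z : Space R => z.1.2.2.1) h1
  have h4 : 0 + (f ((0, 0, 0, 0), t * v, 0)).2.1 = t * (g (0, v)).2 :=
    congrArg (fun z : Space R => z.2.2) h1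
  rw [(coord_of_b hT _).2, add_zero] at h3
  rw [← coord_b_eq_coord_a hT hg, h3, ← h4, zero_add]

/-- If A = 0, the idempotent f has image in the image of T. Since f = f² commutes with T, its image
lies in that of every power of T, and T⁴ = 0. -/
theorem eq_zero_of_coord_a (hT : ∀ y, f (shift k R y) = shift k R (f y))
    (hg : ∀ y, f (embedding k t y) = embedding k t (g y)) (hf : ∀ y, f (f y) = f y)
    (h0 : ∀ v, (f ((v, 0, 0, 0), 0, 0)).1.1 = 0) : f = 0 ∧ g = 0 := by
  have ha : ∀ y, (f y).1.1 = 0 := fun y => by rw [coord_a_eq hT, h0]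
  have hb : ∀ y, (f y).2.1 = 0 := fun y => by
    rw [← hf, coord_b_eq hT _ (ha y), coord_b_eq_coord_a hT hg, h0]
  have h1 : ∀ y : Space R, ∃ z : Space R, f y = shift k R z := fun y =>
    ⟨(((f y).1.2.1, (f y).1.2.2.1, (f y).1.2.2.2, 0), (f y).2.2, 0), by
      rw [shift_apply]
      exact Prod.ext (Prod.ext (ha y) rfl) (Prod.ext (hb y) rfl)⟩
  have h2 : ∀ (n : ℕ) (y : Space R), ∃ z : Space R, f y = (shift k R ^ n) (f z) := fun n => by
    induction n with
    | zero => exact fun y => ⟨y, rfl⟩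
    | succ n ih =>
      intro y
      obtain ⟨z, hz⟩ := h1 y
      obtain ⟨z', hz'⟩ := ih z
      exact ⟨z', by rw [← hf, hz, hT, hz', pow_succ', Module.End.mul_apply]⟩
  have hf0 : ∀ y, f y = 0 := fun y => by
    obtain ⟨z, hz⟩ := h2 4 y
    rw [hz, shift_pow_four, LinearMap.zero_apply]
  refine ⟨LinearMap.ext hf0, LinearMap.ext fun y => embedding_injective (k := k) t ?_⟩
  rw [← hg, hf0, LinearMap.zero_apply, map_zero]

/-- The pair of the nilpotent operator and the subspace has no nontrivial idempotent
endomorphisms if the parameter generates a ring without nontrivial idempotents. -/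
theorem idempotent_trivial (ht : ∀ A : R →ₗ[k] R, (∀ v, A (t * v) = t * A v) → ∀ v, A v = A 1 * v)
    (hR : ∀ r : R, r * r = r → r = 0 ∨ r = 1)
    (hT : ∀ y, f (shift k R y) = shift k R (f y))
    (hg : ∀ y, f (embedding k t y) = embedding k t (g y)) (hf : ∀ y, f (f y) = f y) :
    (f = 0 ∧ g = 0) ∨ (f = 1 ∧ g = 1) := by
  let A : R →ₗ[k] R :=
    { toFun := fun v => (f ((v, 0, 0, 0), 0, 0)).1.1
      map_add' := fun v w => by
        rw [← Prod.fst_add, ← Prod.fst_add, ← map_add]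
        simp
      map_smul' := fun r v => by
        rw [RingHom.id_apply, ← Prod.smul_fst, ← Prod.smul_fst, ← map_smul]
        simp }
  have hA : ∀ v, (f ((v, 0, 0, 0), 0, 0)).1.1 = A 1 * v := ht A fun v => coord_a_mul hT hg v
  have hAA : A 1 * A 1 = A 1 := by
    rw [← hA (A 1)]
    exact (coord_a_eq hT _).symm.trans (congrArg (fun z : Space R => z.1.1) (hf _))
  rcases hR _ hAA with h | h
  · exact .inl (eq_zero_of_coord_a hT hg hf fun v => by rw [hA, h, zero_mul])
  · right
    -- The complementary idempotent induces 1 - A = 0 on the top.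
    have := eq_zero_of_coord_a (t := t) (f := 1 - f) (g := 1 - g)
      (fun y => by simp [hT]) (fun y => by simp [hg]) (fun y => by simp [hf])
      (fun v => by simp [hA, h])
    exact ⟨(sub_eq_zero.1 this.1).symm, (sub_eq_zero.1 this.2).symm⟩

end endo

end

end LoopQuiver

/-! ### Truncated polynomial parameters and consequences of admissibility -/

namespace LoopQuiver

open PathAlgebra Polynomial LoopVertex

noncomputable section

variable (k : Type u) [Field k]

/-- The truncated polynomial ring. -/
abbrev TruncPoly (m : ℕ) : Type u := AdjoinRoot ((X : k[X]) ^ (m + 1))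

theorem finrank_truncPoly (m : ℕ) : Module.finrank k (TruncPoly k m) = m + 1 := by
  rw [(AdjoinRoot.powerBasis (pow_ne_zero (m + 1) (X_ne_zero (R := k)))).finrank,
    AdjoinRoot.powerBasis_dim, natDegree_X_pow]

instance (m : ℕ) : FiniteDimensional k (TruncPoly k m) :=
  FiniteDimensional.of_finrank_pos (by rw [finrank_truncPoly]; omega)

variable {k}

/-- The underlying space of the members of the family of representations. -/
abbrev RepSpace (k : Type u) [Field k] (m : ℕ) : Type u :=
  Space (TruncPoly k m) × TruncPoly k m × TruncPoly k m

/-- For a lift p, x^(m+1) divides p(p - 1), and x cannot divide both factors. -/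
theorem truncPoly_idempotent (m : ℕ) (r : TruncPoly k m) (hr : r * r = r) : r = 0 ∨ r = 1 := by
  obtain ⟨p, rfl⟩ := AdjoinRoot.mk_surjective r
  rw [← map_mul, AdjoinRoot.mk_eq_mk] at hr
  rw [AdjoinRoot.mk_eq_zero, ← map_one (AdjoinRoot.mk _), AdjoinRoot.mk_eq_mk]
  have hp : p * p - p = p * (p - 1) := by ring
  rw [hp] at hr
  by_cases h : X ∣ p - 1
  · right
    have h1 : ¬ X ∣ p := fun h1 => by
      have := dvd_sub h1 h
      rw [sub_sub_cancel] at this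
      exact not_isUnit_X (isUnit_of_dvd_one this)
    exact ((irreducible_X.coprime_iff_not_dvd.2 h1).pow_left).dvd_of_dvd_mul_left hr
  · left
    exact ((irreducible_X.coprime_iff_not_dvd.2 h).pow_left).dvd_of_dvd_mul_right hr

theorem truncPoly_linearMap (m : ℕ) (A : TruncPoly k m →ₗ[k] TruncPoly k m)
    (hA : ∀ v, A (AdjoinRoot.root _ * v) = AdjoinRoot.root _ * A v) (v : TruncPoly k m) :
    A v = A 1 * v := by
  obtain ⟨p, rfl⟩ := AdjoinRoot.mk_surjective v
  have hpow : ∀ n : ℕ, A (AdjoinRoot.root _ ^ n) = A 1 * AdjoinRoot.root _ ^ n := fun n => by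
    induction n with
    | zero => simp
    | succ n ih =>
      have h : AdjoinRoot.root ((X : k[X]) ^ (m + 1)) ^ (n + 1) =
          AdjoinRoot.root _ * AdjoinRoot.root _ ^ n := pow_succ' _ n
      rw [h, hA, ih, mul_left_comm]
  induction p using Polynomial.induction_on' with
  | add p q hp hq => rw [map_add, map_add, hp, hq, mul_add]
  | monomial n r =>
    have h : AdjoinRoot.mk ((X : k[X]) ^ (m + 1)) (monomial n r) = r • AdjoinRoot.root _ ^ n := by
      rw [← C_mul_X_pow_eq_monomial, map_mul, map_pow, AdjoinRoot.mk_X, AdjoinRoot.mk_C,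
        Algebra.smul_def]
      rfl
    rw [h, map_smul, hpow, mul_smul_comm]

theorem toMatrix_mul_two_two (f g : PathAlgebra k LoopVertex) :
    toMatrix k (f * g) two two = toMatrix k f two two * toMatrix k g two two := by
  obtain ⟨-, -, h21, -, -⟩ := isPathMatrix_toMatrix k f
  obtain ⟨-, -, -, -, h32⟩ := isPathMatrix_toMatrix k g
  rw [map_mul, Matrix.mul_apply, sum_vertices, h21, h32, zero_mul, mul_zero, zero_add, add_zero]

theorem toMatrix_mul_three_three (f g : PathAlgebra k LoopVertex) :
    toMatrix k (f * g) three three = toMatrix k f three three * toMatrix k g three three := by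
  obtain ⟨-, -, -, h31, h32⟩ := isPathMatrix_toMatrix k f
  rw [map_mul, Matrix.mul_apply, sum_vertices, h31, h32, zero_mul, zero_mul, zero_add, zero_add]

theorem coeff_zero_of_mem_arrowIdeal {f : PathAlgebra k LoopVertex}
    (hf : f ∈ arrowIdeal k LoopVertex) :
    (toMatrix k f two two).coeff 0 = 0 ∧ (toMatrix k f three three).coeff 0 = 0 := by
  let δ : PathAlgebra k LoopVertex →+* k × k :=
    { toFun := fun f => ((toMatrix k f two two).coeff 0, (toMatrix k f three three).coeff 0)
      map_one' := by simp
      map_mul' := fun f g => by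
        rw [toMatrix_mul_two_two, toMatrix_mul_three_three, mul_coeff_zero, mul_coeff_zero]
        rfl
      map_zero' := by simp
      map_add' := fun f g => by simp }
  have h : TwoSidedIdeal.span {f : PathAlgebra k LoopVertex |
      ∃ (x y : LoopVertex) (s : x ⟶ y), f = ofArrow k s} ≤ TwoSidedIdeal.ker δ := by
    rw [TwoSidedIdeal.span_le]
    rintro _ ⟨x, y, s, rfl⟩
    change LoopArrow x y at s
    have ha : ((Matrix.single one two 1 : Matrix LoopVertex LoopVertex k[X]) two two).coeff 0 = 0 ∧
        ((Matrix.single one two 1 : Matrix LoopVertex LoopVertex k[X]) three three).coeff 0 = 0 := by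
      simp
    have hb : ((Matrix.single two two X : Matrix LoopVertex LoopVertex k[X]) two two).coeff 0 = 0 ∧
        ((Matrix.single two two X : Matrix LoopVertex LoopVertex k[X]) three three).coeff 0 = 0 := by
      simp
    have hc : ((Matrix.single two three 1 : Matrix LoopVertex LoopVertex k[X]) two two).coeff 0 = 0 ∧
        ((Matrix.single two three 1 : Matrix LoopVertex LoopVertex k[X]) three three).coeff 0 =
          0 := by
      simp
    refine (TwoSidedIdeal.mem_ker δ).2 (Prod.ext ?_ ?_)
    · cases s
      · exact (congrArg (fun M => (M two two).coeff 0) (toMatrix_a k)).trans ha.1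
      · exact (congrArg (fun M => (M two two).coeff 0) (toMatrix_b k)).trans hb.1
      · exact (congrArg (fun M => (M two two).coeff 0) (toMatrix_c k)).trans hc.1
    · cases s
      · exact (congrArg (fun M => (M three three).coeff 0) (toMatrix_a k)).trans ha.2
      · exact (congrArg (fun M => (M three three).coeff 0) (toMatrix_b k)).trans hb.2
      · exact (congrArg (fun M => (M three three).coeff 0) (toMatrix_c k)).trans hc.2
  have := (TwoSidedIdeal.mem_ker δ).1 (h (TwoSidedIdeal.mem_asIdeal.1 hf))
  exact ⟨congrArg Prod.fst this, congrArg Prod.snd this⟩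

/-- Diagonal entries multiply independently by triangularity. On the arrow ideal they have no
constant term at vertices 2 and 3, and the (3,3) entry is constant. -/
theorem entries_of_mem_arrowIdeal_sq {f : PathAlgebra k LoopVertex}
    (hf : f ∈ arrowIdeal k LoopVertex ^ 2) :
    X ^ 2 ∣ toMatrix k f two two ∧ toMatrix k f three three = 0 := by
  let K : Ideal (PathAlgebra k LoopVertex) :=
    { carrier := {f | X ^ 2 ∣ toMatrix k f two two ∧ toMatrix k f three three = 0}
      add_mem' := fun {f g} hf hg => by
        refine ⟨?_, ?_⟩
        · rw [map_add]; exact dvd_add hf.1 hg.1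
        · rw [map_add, Matrix.add_apply, hf.2, hg.2, add_zero]
      zero_mem' := by simp
      smul_mem' := fun f g hg => by
        rw [smul_eq_mul]
        refine ⟨?_, ?_⟩
        · rw [toMatrix_mul_two_two]; exact hg.1.mul_left _
        · rw [toMatrix_mul_three_three, hg.2, mul_zero] }
  have hK : arrowIdeal k LoopVertex ^ 2 ≤ K := by
    have hsq : arrowIdeal k LoopVertex ^ 2 = arrowIdeal k LoopVertex * arrowIdeal k LoopVertex := by
      change arrowIdeal k LoopVertex ^ (1 + 1) = _
      rw [Submodule.pow_succ, Submodule.pow_one]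
    rw [hsq, Ideal.mul_le]
    intro r hr s hs
    obtain ⟨hr2, hr3⟩ := coeff_zero_of_mem_arrowIdeal hr
    obtain ⟨hs2, -⟩ := coeff_zero_of_mem_arrowIdeal hs
    refine ⟨?_, ?_⟩
    · rw [toMatrix_mul_two_two, pow_two]
      exact mul_dvd_mul (X_dvd_iff.2 hr2) (X_dvd_iff.2 hs2)
    · rw [toMatrix_mul_three_three, (isPathMatrix_toMatrix k r).2.1, hr3, C_0, zero_mul]
  exact hK hf

theorem X_pow_mem_ker22 {I : Ideal (PathAlgebra k LoopVertex)} [I.IsTwoSided] {N : ℕ}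
    (hN : N ≠ 0) (hI : arrowIdeal k LoopVertex ^ N ≤ I) :
    X ^ N ∈ ker22 (Ideal.Quotient.mkₐ k I) := by
  obtain ⟨n, rfl⟩ := Nat.exists_eq_succ_of_ne_zero hN
  have hb : b k ∈ arrowIdeal k LoopVertex :=
    TwoSidedIdeal.mem_asIdeal.2 (TwoSidedIdeal.subset_span ⟨two, two, LoopArrow.β, rfl⟩)
  rw [mem_ker22, entry_two_two, loopPoly_X_pow_succ]
  exact Ideal.Quotient.eq_zero_iff_mem.2 (hI (Ideal.pow_mem_pow hb _))

/-- An endomorphism commuting with the action of the path algebra is given by endomorphisms of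
the two parts of a representation. -/
theorem rep_end_eq {V : Type v} {U : Type w} [AddCommGroup V] [Module k V] [AddCommGroup U]
    [Module k U] (T : Module.End k V) (g : U →ₗ[k] V) (F : Module.End k (V × U))
    (hF : ∀ f y, F (rep T g f y) = rep T g f (F y)) :
    ∃ (F₁ : Module.End k V) (F₂ : Module.End k U), (∀ y, F y = (F₁ y.1, F₂ y.2)) ∧
      (∀ y, F₁ (T y) = T (F₁ y)) ∧ ∀ y, F₁ (g y) = g (F₂ y) := by
  have hb : ∀ y, rep T g (b k) y = (T y.1, 0) := fun y => by
    rw [rep_apply, toMatrix_b]; simp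
  have hc : ∀ y, rep T g (c k) y = (g y.2, 0) := fun y => by
    rw [rep_apply, toMatrix_c]; simp
  have h2 : ∀ y, rep T g (idem k two) y = (y.1, 0) := fun y => by
    rw [rep_apply, toMatrix_idem]; simp
  have h3 : ∀ y, rep T g (idem k three) y = (0, y.2) := fun y => by
    rw [rep_apply, toMatrix_idem]; simp
  have hF1 : ∀ y, F (y, 0) = ((F (y, 0)).1, 0) := fun y => by
    have := hF (idem k two) (y, 0)
    rwa [h2, h2] at this
  have hF2 : ∀ y, F (0, y) = (0, (F (0, y)).2) := fun y => by
    have := hF (idem k three) (0, y)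
    rwa [h3, h3] at this
  refine ⟨LinearMap.fst k V U ∘ₗ F ∘ₗ LinearMap.inl k V U,
    LinearMap.snd k V U ∘ₗ F ∘ₗ LinearMap.inr k V U, fun y => ?_, fun y => ?_, fun y => ?_⟩
  · have : F y = F (y.1, 0) + F (0, y.2) := by rw [← map_add]; simp
    rw [this, hF1, hF2]
    simp
  · have := hF (b k) (y, 0)
    rw [hb, hb] at this
    exact congrArg Prod.fst this
  · have := hF (c k) (0, y)
    rw [hc, hc] at this
    exact congrArg Prod.fst this

theorem rep_eq_zero {V : Type v} {U : Type w} [AddCommGroup V] [Module k V] [AddCommGroup U]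
    [Module k U] {T : Module.End k V} (g : U →ₗ[k] V) {n : ℕ} (hT : T ^ n = 0)
    {f : PathAlgebra k LoopVertex} (h22 : X ^ n ∣ toMatrix k f two two)
    (h23 : X ^ n ∣ toMatrix k f two three) (h33 : toMatrix k f three three = 0) :
    rep T g f = 0 := by
  have h : ∀ p : k[X], X ^ n ∣ p → aeval T p = 0 := by
    rintro _ ⟨q, rfl⟩
    rw [map_mul, map_pow, aeval_X, hT, zero_mul]
  refine LinearMap.ext fun y => ?_
  rw [rep_apply, h _ h22, h _ h23, h33]
  simp

end

end LoopQuiver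

/-! ### Proof of the theorem -/

open PathAlgebra Polynomial LoopVertex LoopQuiver in
theorem mainTheorem7 {k : Type u} [Field k] {A : Type v} [Ring A] [Algebra k A]
    [FiniteDimensional k A] (hQ : HasOrdinaryQuiver k A LoopVertex)
    (hfin : IsOfFiniteRepresentationType A) : Nontrivial (HochschildH1 k A) := by
  obtain ⟨I, hI2, ⟨hI, N, hN, hNI⟩, ⟨⟨e⟩⟩⟩ := hQ
  have hI' : ∀ f, Ideal.Quotient.mkₐ k I f = 0 → f ∈ I := fun f hf =>
    Ideal.Quotient.eq_zero_iff_mem.1 hf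
  rcases exists_derivation_or_X_pow_dvd (Ideal.Quotient.mkₐ_surjective k I) (fun f hf => by
      have := (entries_of_mem_arrowIdeal_sq (hI (hI' _ hf))).1
      rwa [entry_two_two, toMatrix_loopPoly, Matrix.single_apply_same] at this)
      (X_pow_mem_ker22 (by omega) hNI) with ⟨D, hD⟩ | ⟨h22, h23⟩
  · exact e.nontrivial_hochschildH1 hD
  exfalso
  let t : ∀ m, TruncPoly k m := fun m => AdjoinRoot.root _
  let ρ : ∀ m, PathAlgebra k LoopVertex →ₐ[k] Module.End k (RepSpace k m) := fun m =>
    rep (shift k (TruncPoly k m)) (embedding k (t m))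
  -- With zero space at vertex 1, only the (2,2), (2,3) and (3,3) entries act.
  have hρ : ∀ m f, f ∈ I → ρ m f = 0 := fun m f hf => by
    have hf0 : Ideal.Quotient.mkₐ k I f = 0 := Ideal.Quotient.eq_zero_iff_mem.2 hf
    exact rep_eq_zero _ (shift_pow_four k) (h22 _ (map_entry_eq_zero _ hf0 two two))
      (h23 _ (map_entry_eq_zero _ hf0 two three)) (entries_of_mem_arrowIdeal_sq (hI hf)).2
  let _ : ∀ m, Module (PathAlgebra k LoopVertex ⧸ I) (RepSpace k m) := fun m =>
    Module.compHom (RepSpace k m) (Ideal.Quotient.lift I (ρ m).toRingHom (hρ m))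
  have hsmul : ∀ m f (y : RepSpace k m), Ideal.Quotient.mk I f • y = ρ m f y := fun m f y => rfl
  have : ∀ m, IsScalarTower k (PathAlgebra k LoopVertex ⧸ I) (RepSpace k m) := fun m =>
    ⟨fun r x y => by
    obtain ⟨f, rfl⟩ := Ideal.Quotient.mk_surjective x
    have h : r • Ideal.Quotient.mk I f = Ideal.Quotient.mk I (r • f) := rfl
    rw [h, hsmul, hsmul, map_smul]
    rfl⟩
  -- Six copies of the truncated polynomial ring at vertex 2 and two at vertex 3; the dimension
  -- separates the members of the family.
  have hrank : ∀ m, Module.finrank k (RepSpace k m) = 8 * (m + 1) := fun m => by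
    simp only [Module.finrank_prod, finrank_truncPoly]
    ring
  have : ∀ m, FiniteDimensional k (RepSpace k m) := fun m => inferInstance
  have : ∀ m, Nontrivial (RepSpace k m) := fun m =>
    Module.nontrivial_of_finrank_pos (R := k) (by rw [hrank]; omega)
  refine e.false_of_isOfFiniteRepresentationType hfin (RepSpace k) (fun m F hF => ?_)
    fun m m' ⟨i⟩ => ?_
  · obtain ⟨F₁, F₂, hF12, hT, hg⟩ := rep_end_eq (shift k (TruncPoly k m)) (embedding k (t m))
      (F.restrictScalars k) (fun f y => F.map_smul (Ideal.Quotient.mk I f) y)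
    have hF12' : ∀ y, F y = (F₁ y.1, F₂ y.2) := hF12
    have hidem : ∀ y, F₁ (F₁ y) = F₁ y := fun y => by
      have := LinearMap.congr_fun hF (y, 0)
      rw [Module.End.mul_apply, hF12', hF12'] at this
      exact congrArg Prod.fst this
    refine (idempotent_trivial (truncPoly_linearMap m) (truncPoly_idempotent m) hT hg hidem).imp
      (fun h => ?_) (fun h => ?_)
    · refine LinearMap.ext fun y => ?_
      rw [hF12', h.1, h.2]
      rfl
    · refine LinearMap.ext fun y => ?_
      rw [hF12', h.1, h.2]
      rfl
  · have h := (i.restrictScalars k).finrank_eq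
    rw [hrank, hrank] at h
    omega
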